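/- Let $N, T \ge 1$ be integers and regard $\mathbb{Z}^N$ as the lattice graph in which $x \sim y$ iff $\sum_{i=1}^N |x_i-y_i| = 1$, with $\Delta u(x)=\sum_{y\sim x}(u(y)-u(x))$ and $|\nabla u|^2(x)=\frac12\sum_{y\sim x}(u(y)-u(x))^2$. Let $V:\mathbb{Z}^N\to\mathbb{R}$ be $T$-periodic, i.e. $V(x+Te_i)=V(x)$ for all $x\in\mathbb{Z}^N$ and $1\le i\le N$, with $\inf V>-1$. Let $H^1(\mathbb{Z}^N)$ be the completion of the finitely supported functions in the norm $\big(\sum_x |\nabla u|^2(x)+\sum_x u(x)^2\big)^{1/2}$, let $$X=\Big\{u\in H^1(\mathbb{Z}^N): \sum_{x}(V(x)+1)u(x)^2<\infty\Big\},\qquad \|u\|_X^2=\sum_x\big(|\nabla u|^2+(V+1)u^2\big)(x),$$ and, for $u\in X$ (with $0\log 0=0$), let $$J(u)=\frac12\sum_x\big(|\nabla u|^2+(V+1)u^2\big)(x)-\frac12\sum_x u(x)^2\log u(x)^2\in(-\infty,+\infty].$$ Define the Nehari manifold $$\mathcal N=\Big\{u\in X\setminus\{0\}: J(u)<\infty,\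 \sum_x\big(|\nabla u|^2+Vu^2\big)(x)=\sum_x u(x)^2\log u(x)^2\Big\},$$ the Nehari level $c_{\mathcal N}=\inf_{u\in\mathcal N}J(u)$, and the mountain-pass level $$c=\inf_{\gamma}\ \sup_{s\in[0,1]}J(\gamma(s)),$$ the infimum being over all $\gamma\in C([0,1],X)$ with $\gamma(0)=0$ and $J(\gamma(1))<0$. A solution is a function $u \in X$ with $-\Delta u(x)+V(x)u(x)=u(x)\log u(x)^2$ for every $x\in\mathbb{Z}^N$; a ground state solution is a solution $u\ne 0$ with $J(u)<\infty$ and $J(u)\le J(w)$ for every solution $w\neq 0$. Then a ground state solution exists, and $c=c_{\mathcal N}$. Moreover, every ground state solution $u$ satisfies $u\in\mathcal N$ and $J(u)=c=c_{\mathcal N}$, and either $u(x)>0$ for all $x\in\mathbb{Z}^N$ or $u(x)<0$ for all $x\in\mathbb{Z}^N$. -/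

import Mathlib

open Filter Topology
open scoped ENNReal

namespace LogSchrodinger

/-- The lattice graph on the vertex set `ℤ^N`: `x ∼ y` iff `∑ |x_i - y_i| = 1`. -/
def lattice (N : ℕ) : SimpleGraph (Fin N → ℤ) where
  Adj x y := ∑ i, |x i - y i| = 1
  symm := ⟨fun x y h => by simpa only [abs_sub_comm] using h⟩
  loopless := ⟨fun x h => by simp at h⟩

theorem finite_neighborSet_lattice (N : ℕ) (x : Fin N → ℤ) :
    ((lattice N).neighborSet x).Finite := by
  refine (Set.finite_Icc (x - 1) (x + 1)).subset ?_
  intro y hy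
  have h1 : ∑ i, |x i - y i| = 1 := hy
  have h2 : ∀ i, |x i - y i| ≤ 1 := fun i => by
    rw [← h1]
    exact Finset.single_le_sum (f := fun j => |x j - y j|) (fun j _ => abs_nonneg _)
      (Finset.mem_univ i)
  constructor <;> intro i <;> have h3 := abs_le.mp (h2 i) <;>
    simp only [Pi.sub_apply, Pi.add_apply, Pi.one_apply] <;> omega

noncomputable instance (N : ℕ) (x : Fin N → ℤ) : Fintype ((lattice N).neighborSet x) :=
  (finite_neighborSet_lattice N x).fintype

/-- `g` is `T`-periodic on `ℤ^N`: `g (x + T e_i) = g x` for all `x` and all `i`. -/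
def IsPeriodic {N : ℕ} (T : ℕ) (g : (Fin N → ℤ) → ℝ) : Prop :=
  ∀ (x : Fin N → ℤ) (i : Fin N), g (x + Pi.single i (T : ℤ)) = g x

/-- The extended-real integral of `f` against the counting measure, the sum of the positive parts
minus the sum of the negative parts. It is only used where at least one of these is finite. -/
noncomputable def integral {𝕍 : Type*} (f : 𝕍 → ℝ) : EReal :=
  ((∑' x, ENNReal.ofReal (f x) : ℝ≥0∞) : EReal) - ((∑' x, ENNReal.ofReal (-f x) : ℝ≥0∞) : EReal)

section Graph

variable {𝕍 : Type*} (G : SimpleGraph 𝕍) [G.LocallyFinite]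

/-- The graph Laplacian `Δu(x) = ∑_{y ∼ x} (u(y) - u(x))`. -/
noncomputable def laplacian (u : 𝕍 → ℝ) (x : 𝕍) : ℝ :=
  ∑ y ∈ G.neighborFinset x, (u y - u x)

/-- The gradient form `Γ(u, v)(x) = ½ ∑_{y ∼ x} (u(y) - u(x)) (v(y) - v(x))`;
thus `|∇u|² (x) = Γ(u, u)(x)`. -/
noncomputable def gradForm (u v : 𝕍 → ℝ) (x : 𝕍) : ℝ :=
  1 / 2 * ∑ y ∈ G.neighborFinset x, (u y - u x) * (v y - v x)

/-- The square of the `H¹` norm, `∑ |∇u|² + ∑ u²`, as an extended nonnegative real. -/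
noncomputable def h1NormSq (u : 𝕍 → ℝ) : ℝ≥0∞ :=
  ∑' x, ENNReal.ofReal (gradForm G u u x) + ∑' x, ENNReal.ofReal (u x ^ 2)

/-- `H¹(𝕍)`, the completion of the finitely supported functions in the `H¹` norm. Since that norm
dominates every evaluation, the completion is the space of those functions on `𝕍` that are
limits of finitely supported functions in the `H¹` norm. -/
def H1 : Set (𝕍 → ℝ) :=
  {u | ∀ ε : ℝ≥0∞, 0 < ε → ∃ φ : 𝕍 → ℝ, (Function.support φ).Finite ∧ h1NormSq G (u - φ) < ε}

/-- The space `X = {u ∈ H¹(𝕍) : ∫ (V + 1) u² dμ < ∞}` (for a potential `V ≥ -1`). -/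
def X (V : 𝕍 → ℝ) : Set (𝕍 → ℝ) :=
  {u | u ∈ H1 G ∧ ∑' x, ENNReal.ofReal ((V x + 1) * u x ^ 2) < ⊤}

/-- The square of the norm of `X`, `∫ |∇u|² + (V + 1) u² dμ`. -/
noncomputable def xNormSq (V u : 𝕍 → ℝ) : ℝ≥0∞ :=
  ∑' x, ENNReal.ofReal (gradForm G u u x + (V x + 1) * u x ^ 2)

/-- The energy `J(u) = ½ ∫ |∇u|² + (V + 1) u² dμ - ½ ∫ u² log u² dμ`. For `u` in `X` the first
integral is finite and the second one lies in `[-∞, ∞)`, so that `J(u)` lies in `(-∞, ∞]`. -/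
noncomputable def J (V u : 𝕍 → ℝ) : EReal :=
  ((1 / 2 : ℝ) : EReal) * integral (fun x => gradForm G u u x + (V x + 1) * u x ^ 2)
    - ((1 / 2 : ℝ) : EReal) * integral (fun x => u x ^ 2 * Real.log (u x ^ 2))

/-- The effective domain `D(J) = {u ∈ X : J(u) < ∞}`. -/
def effDomain (V : 𝕍 → ℝ) : Set (𝕍 → ℝ) :=
  {u | u ∈ X G V ∧ J G V u < ⊤}

/-- The pairing `⟨J'(u), v⟩ = ∫ Γ(u, v) + V u v dμ - ∫ u v log u² dμ`. -/
noncomputable def derivJ (V u v : 𝕍 → ℝ) : EReal :=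
  integral (fun x => gradForm G u v x + V x * u x * v x)
    - integral (fun x => u x * v x * Real.log (u x ^ 2))

/-- The Nehari manifold `{u ∈ D(J) \ {0} : ⟨J'(u), u⟩ = 0}`. -/
def nehari (V : 𝕍 → ℝ) : Set (𝕍 → ℝ) :=
  {u | u ∈ effDomain G V ∧ u ≠ 0 ∧ derivJ G V u u = 0}

/-- The Nehari level, the infimum of `J` over the Nehari manifold. -/
noncomputable def nehariLevel (V : 𝕍 → ℝ) : EReal :=
  ⨅ u ∈ nehari G V, J G V u

/-- The paths `γ ∈ C([0, 1], X)` with `γ(0) = 0` and `J(γ(1)) < 0`. -/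
def mountainPaths (V : 𝕍 → ℝ) : Set (unitInterval → 𝕍 → ℝ) :=
  {γ | (∀ s, γ s ∈ X G V) ∧
    (∀ s, Tendsto (fun r => xNormSq G V (γ r - γ s)) (𝓝 s) (𝓝 0)) ∧
    γ 0 = 0 ∧ J G V (γ 1) < 0}

/-- The mountain-pass level `inf_γ sup_s J(γ(s))`. -/
noncomputable def mountainPassLevel (V : 𝕍 → ℝ) : EReal :=
  ⨅ γ ∈ mountainPaths G V, ⨆ s, J G V (γ s)

/-- `u ∈ X` solves `-Δu + V u = u log u²` at every vertex (`0 log 0 = 0`). -/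
def IsSolution (V u : 𝕍 → ℝ) : Prop :=
  u ∈ X G V ∧ ∀ x, -laplacian G u x + V x * u x = u x * Real.log (u x ^ 2)

/-- A ground state solution: a nontrivial solution whose energy is finite and least among all
nontrivial solutions. -/
def IsGroundState (V u : 𝕍 → ℝ) : Prop :=
  IsSolution G V u ∧ u ≠ 0 ∧ J G V u < ⊤ ∧
    ∀ w, IsSolution G V w → w ≠ 0 → J G V u ≤ J G V w

end Graph

end LogSchrodinger

/-! The whole problem reduces to one minimization on the unit sphere of `ℓ²`. Vertex degrees and `V`
are bounded, so `H1` and `X` are both `ℓ²` (`mem_H1_iff`, `mem_X_iff`). Writing `action V u` for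
`⟨J'(u), u⟩`, one has `J = (action + mass) / 2` where `u² log u²` is summable and `J = ⊤` elsewhere.

Scaling gives `action (c u) = c² (action u - log c² * mass u)`. Hence, if `d` is the infimum of the
action on the unit sphere, `mass u * (d - log (mass u)) ≤ action u` (`mass_mul_le_action`). The
value `mass = exp d` is critical: on the Nehari manifold `J = mass / 2` and `mass ≥ exp d`, while on
the sphere `mass = exp d` always `J ≥ exp d / 2`. A mountain path runs from mass `0` to mass above
`exp d`, so it crosses that sphere; conversely the ray through a Nehari point has its maximal energy
at that point. Both levels therefore equal `exp d / 2` once `d` is attained.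

Attainment (`exists_action_minimizer`) uses period translations to prevent vanishing, and the strict
inequality `m log m + (1 - m) log (1 - m) < 0` for `0 < m < 1` to exclude splitting. A one-vertex
variation then shows that a minimizer rescaled to mass `exp d` solves the equation
(`euler_lagrange`). Nonzero solutions lie on the Nehari manifold, so ground states are exactly such
minimizers. If `u` is one then so is `|u|`, and the maximum principle fixes the sign. -/

namespace LogSchrodinger

/-! ### Neighbours, connectedness and periods of the lattice. -/

section LatticeCombinatorics

variable {N : ℕ}

theorem lattice_adj_iff (x y : Fin N → ℤ) :
    (lattice N).Adj x y ↔ ∃ i, y = x + Pi.single i 1 ∨ y = x - Pi.single i 1 := by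
  change ∑ i, |x i - y i| = 1 ↔ _
  constructor
  · intro h
    have hne : ∃ i, x i ≠ y i := by
      by_contra hcon
      push Not at hcon
      simp [hcon] at h
    obtain ⟨i, hi⟩ := hne
    have h1 : |x i - y i| + ∑ j ∈ Finset.univ.erase i, |x j - y j| = 1 :=
      (Finset.add_sum_erase _ (fun j => |x j - y j|) (Finset.mem_univ i)).trans h
    have h2 : 1 ≤ |x i - y i| := Int.one_le_abs (sub_ne_zero.mpr hi)
    have h3 : 0 ≤ ∑ j ∈ Finset.univ.erase i, |x j - y j| :=
      Finset.sum_nonneg fun j _ => abs_nonneg _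
    have h4 : ∑ j ∈ Finset.univ.erase i, |x j - y j| = 0 := by omega
    have h5 : |x i - y i| = 1 := by omega
    have h6 : ∀ j, j ≠ i → y j = x j := by
      intro j hj
      have := (Finset.sum_eq_zero_iff_of_nonneg (fun j _ => abs_nonneg _)).1 h4 j
        (Finset.mem_erase.2 ⟨hj, Finset.mem_univ j⟩)
      have := abs_eq_zero.1 this
      omega
    refine ⟨i, ?_⟩
    rcases (abs_eq (by norm_num : (0 : ℤ) ≤ 1)).1 h5 with h7 | h7
    · right
      funext j
      by_cases hj : j = i
      · subst hj; simp; omega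
      · simp [hj, h6 j hj]
    · left
      funext j
      by_cases hj : j = i
      · subst hj; simp; omega
      · simp [hj, h6 j hj]
  · rintro ⟨i, rfl | rfl⟩
    · rw [Finset.sum_eq_single i] <;> simp +contextual
    · rw [Finset.sum_eq_single i] <;> simp +contextual

theorem sum_neighborFinset_lattice (x : Fin N → ℤ) (f : (Fin N → ℤ) → ℝ) :
    ∑ y ∈ (lattice N).neighborFinset x, f y
      = ∑ i, (f (x + Pi.single i 1) + f (x - Pi.single i 1)) := by
  classical
  have hone : ∀ i j : Fin N, (Pi.single i (1 : ℤ) : Fin N → ℤ) = Pi.single j 1 → i = j := by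
    intro i j h
    by_contra hij
    have := congrFun h i
    simp [hij] at this
  have himg : (lattice N).neighborFinset x
      = (Finset.univ.image fun i : Fin N => x + Pi.single i 1)
        ∪ (Finset.univ.image fun i : Fin N => x - Pi.single i 1) := by
    ext y
    simp only [SimpleGraph.mem_neighborFinset, lattice_adj_iff, Finset.mem_union,
      Finset.mem_image, Finset.mem_univ, true_and]
    constructor
    · rintro ⟨i, h | h⟩
      exacts [.inl ⟨i, h.symm⟩, .inr ⟨i, h.symm⟩]
    · rintro (⟨i, h⟩ | ⟨i, h⟩)
      exacts [⟨i, .inl h.symm⟩, ⟨i, .inr h.symm⟩]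
  have hdisj : Disjoint (Finset.univ.image fun i : Fin N => x + Pi.single i 1)
      (Finset.univ.image fun i : Fin N => x - Pi.single i 1) := by
    rw [Finset.disjoint_left]
    simp only [Finset.mem_image, Finset.mem_univ, true_and, not_exists, forall_exists_index]
    rintro _ i rfl j h
    have h1 := congrFun h i
    by_cases hij : i = j
    · subst hij; simp at h1; omega
    · simp [hij] at h1
  rw [himg, Finset.sum_union hdisj, Finset.sum_image, Finset.sum_image, Finset.sum_add_distrib]
  · intro i _ j _ h
    exact hone i j (sub_right_injective h)
  · intro i _ j _ h
    exact hone i j (add_right_injective x h)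

/-- A property of lattice points that passes to all neighbours and holds somewhere holds
everywhere: the lattice is connected. -/
theorem lattice_induction {p : (Fin N → ℤ) → Prop} (x₀ : Fin N → ℤ) (h₀ : p x₀)
    (h : ∀ x y, (lattice N).Adj x y → p x → p y) (y : Fin N → ℤ) : p y := by
  classical
  have hstep : ∀ (i : Fin N) (k : ℤ) (x : Fin N → ℤ), p x → p (x + Pi.single i k) := by
    intro i k
    induction k with
    | zero => intro x hx; simpa using hx
    | succ k ih =>
      intro x hx
      rw [Pi.single_add, ← add_assoc]
      exact h _ _ ((lattice_adj_iff _ _).2 ⟨i, .inl rfl⟩) (ih x hx)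
    | pred k ih =>
      intro x hx
      rw [Pi.single_sub, ← add_sub_assoc]
      exact h _ _ ((lattice_adj_iff _ _).2 ⟨i, .inr rfl⟩) (ih x hx)
  have hsum : ∀ s : Finset (Fin N), p (x₀ + ∑ i ∈ s, Pi.single i (y i - x₀ i)) := by
    intro s
    induction s using Finset.induction_on with
    | empty => simpa using h₀
    | insert i s hi ih =>
      rw [Finset.sum_insert hi, add_comm (Pi.single i _), ← add_assoc]
      exact hstep i _ _ ih
  have := hsum Finset.univ
  rwa [show x₀ + ∑ i, Pi.single i (y i - x₀ i) = y by
    rw [Finset.univ_sum_single (fun i => y i - x₀ i)]; funext i; simp] at this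

theorem gradForm_lattice (u v : (Fin N → ℤ) → ℝ) (x : Fin N → ℤ) :
    gradForm (lattice N) u v x = 1 / 2 * ∑ i,
      ((u (x + Pi.single i 1) - u x) * (v (x + Pi.single i 1) - v x)
        + (u (x - Pi.single i 1) - u x) * (v (x - Pi.single i 1) - v x)) := by
  rw [gradForm, sum_neighborFinset_lattice x fun y => (u y - u x) * (v y - v x)]

theorem laplacian_lattice (u : (Fin N → ℤ) → ℝ) (x : Fin N → ℤ) :
    laplacian (lattice N) u x
      = ∑ i, ((u (x + Pi.single i 1) - u x) + (u (x - Pi.single i 1) - u x)) := by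
  rw [laplacian, sum_neighborFinset_lattice x fun y => u y - u x]

theorem IsPeriodic.add_smul {T : ℕ} {V : (Fin N → ℤ) → ℝ} (hV : IsPeriodic T V)
    (x z : Fin N → ℤ) : V (x + (T : ℤ) • z) = V x := by
  classical
  have hstep : ∀ (i : Fin N) (k : ℤ) (x : Fin N → ℤ), V (x + Pi.single i (T * k)) = V x := by
    intro i k
    induction k with
    | zero => simp
    | succ k ih =>
      intro x
      rw [mul_add, mul_one, Pi.single_add, ← add_assoc, hV, ih]
    | pred k ih =>
      intro x
      rw [← hV _ i, add_assoc, ← Pi.single_add, mul_sub, mul_one, sub_add_cancel, ih]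
  have hsum : ∀ s : Finset (Fin N), V (x + ∑ i ∈ s, Pi.single i (T * z i)) = V x := by
    intro s
    induction s using Finset.induction_on with
    | empty => simp
    | insert i s hi ih =>
      rw [Finset.sum_insert hi, add_comm (Pi.single i _), ← add_assoc, hstep, ih]
  have := hsum Finset.univ
  rwa [Finset.univ_sum_single (fun i => (T : ℤ) * z i)] at this

/-- The fundamental domain `[0, T)^N`. -/
noncomputable def fundamentalBox (N T : ℕ) : Finset (Fin N → ℤ) :=
  Fintype.piFinset fun _ => Finset.Ico 0 (T : ℤ)

theorem exists_mem_fundamentalBox {T : ℕ} (hT : 0 < T) (x : Fin N → ℤ) :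
    ∃ z : Fin N → ℤ, ∃ y ∈ fundamentalBox N T, y + (T : ℤ) • z = x := by
  refine ⟨fun i => x i / T, fun i => x i % T, ?_, ?_⟩
  · have hT' : (0 : ℤ) < T := by exact_mod_cast hT
    simp only [fundamentalBox, Fintype.mem_piFinset, Finset.mem_Ico]
    exact fun i => ⟨Int.emod_nonneg _ hT'.ne', Int.emod_lt_of_pos _ hT'⟩
  · funext i
    simp [Int.emod_add_mul_ediv]

theorem IsPeriodic.bddAbove {T : ℕ} (hT : 0 < T) {V : (Fin N → ℤ) → ℝ} (hV : IsPeriodic T V) :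
    ∃ C, ∀ x, V x ≤ C := by
  obtain ⟨C, hC⟩ := ((fundamentalBox N T).image V).bddAbove
  refine ⟨C, fun x => ?_⟩
  obtain ⟨z, y, hy, rfl⟩ := exists_mem_fundamentalBox hT x
  rw [hV.add_smul]
  exact hC (by simpa using ⟨y, hy, rfl⟩)

end LatticeCombinatorics

/-- Square-summable functions. -/
def SqSummable {α : Type*} (u : α → ℝ) : Prop := Summable fun x => u x ^ 2

/-- The square of the `ℓ²` norm. -/
noncomputable def mass {α : Type*} (u : α → ℝ) : ℝ := ∑' x, u x ^ 2

/-! ### Square-summable functions and their mass. -/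

section SquareSummable

variable {α : Type*} {u v : α → ℝ}

theorem SqSummable.mul (hu : SqSummable u) (hv : SqSummable v) :
    Summable fun x => u x * v x := by
  refine Summable.of_norm_bounded (Summable.add hu hv) fun x => ?_
  rw [Real.norm_eq_abs, abs_le]
  constructor <;> nlinarith [sq_nonneg (u x + v x), sq_nonneg (u x - v x), sq_nonneg (u x),
    sq_nonneg (v x)]

theorem SqSummable.add (hu : SqSummable u) (hv : SqSummable v) : SqSummable (u + v) := by
  refine ((Summable.add hu hv).add ((hu.mul hv).mul_left 2)).congr fun x => ?_
  simp only [Pi.add_apply]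
  ring

theorem SqSummable.smul (c : ℝ) (hu : SqSummable u) : SqSummable (c • u) := by
  refine (Summable.mul_left (c ^ 2) hu).congr fun x => ?_
  simp only [Pi.smul_apply, smul_eq_mul]
  ring

theorem SqSummable.sub (hu : SqSummable u) (hv : SqSummable v) : SqSummable (u - v) := by
  simpa [sub_eq_add_neg] using hu.add (hv.smul (-1))

theorem SqSummable.abs (hu : SqSummable u) : SqSummable fun x => |u x| := by
  simpa [SqSummable, sq_abs] using hu

theorem SqSummable.comp_equiv (hu : SqSummable u) (e : α ≃ α) : SqSummable (u ∘ e) :=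
  (Equiv.summable_iff e).2 hu

theorem SqSummable.of_finite_support (hu : (Function.support u).Finite) : SqSummable u :=
  summable_of_hasFiniteSupport (hu.subset fun x hx h => hx (by simp [h]))

theorem SqSummable.indicator (hu : SqSummable u) (s : Set α) : SqSummable (s.indicator u) := by
  refine (Summable.indicator hu s).congr fun x => ?_
  by_cases hx : x ∈ s <;> simp [hx]

theorem mass_nonneg (u : α → ℝ) : 0 ≤ mass u := tsum_nonneg fun x => sq_nonneg (u x)

theorem SqSummable.sq_le_mass (hu : SqSummable u) (x : α) : u x ^ 2 ≤ mass u :=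
  hu.le_tsum x fun y _ => sq_nonneg (u y)

theorem SqSummable.mass_eq_zero_iff (hu : SqSummable u) : mass u = 0 ↔ u = 0 := by
  constructor
  · intro h
    funext x
    have := hu.sq_le_mass x
    rw [h] at this
    exact pow_eq_zero_iff two_ne_zero |>.1 (le_antisymm this (sq_nonneg _))
  · rintro rfl
    simp [mass]

theorem SqSummable.mass_pos (hu : SqSummable u) (h : u ≠ 0) : 0 < mass u :=
  (mass_nonneg u).lt_of_ne' fun h' => h (hu.mass_eq_zero_iff.1 h')

theorem mass_smul (c : ℝ) (u : α → ℝ) : mass (c • u) = c ^ 2 * mass u := by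
  simp [mass, mul_pow, tsum_mul_left]

theorem mass_abs (u : α → ℝ) : mass (fun x => |u x|) = mass u := by
  simp [mass, sq_abs]

end SquareSummable

/-! ### The Dirichlet form and summation by parts. -/

section GradientPairing

variable {N : ℕ} {u v w : (Fin N → ℤ) → ℝ}

theorem SqSummable.shift (hu : SqSummable u) (e : Fin N → ℤ) :
    SqSummable fun x => u (x + e) :=
  hu.comp_equiv (Equiv.addRight e)

/-- The Dirichlet pairing `∑ Γ(u, v)(x)` on the lattice. -/
noncomputable def gradPair (u v : (Fin N → ℤ) → ℝ) : ℝ := ∑' x, gradForm (lattice N) u v x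

theorem gradForm_self_nonneg (u : (Fin N → ℤ) → ℝ) (x : Fin N → ℤ) :
    0 ≤ gradForm (lattice N) u u x := by
  rw [gradForm]
  exact mul_nonneg (by norm_num) (Finset.sum_nonneg fun y _ => mul_self_nonneg _)

theorem gradForm_comm (u v : (Fin N → ℤ) → ℝ) (x : Fin N → ℤ) :
    gradForm (lattice N) u v x = gradForm (lattice N) v u x := by
  simp [gradForm, mul_comm]

theorem gradForm_add_left (u v w : (Fin N → ℤ) → ℝ) (x : Fin N → ℤ) :
    gradForm (lattice N) (u + v) w x
      = gradForm (lattice N) u w x + gradForm (lattice N) v w x := by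
  simp only [gradForm, Pi.add_apply, ← mul_add, ← Finset.sum_add_distrib]
  congr 1
  exact Finset.sum_congr rfl fun y _ => by ring

theorem gradForm_smul_left (c : ℝ) (u w : (Fin N → ℤ) → ℝ) (x : Fin N → ℤ) :
    gradForm (lattice N) (c • u) w x = c * gradForm (lattice N) u w x := by
  simp only [gradForm, Pi.smul_apply, smul_eq_mul, Finset.mul_sum]
  exact Finset.sum_congr rfl fun y _ => by ring

theorem gradForm_shift (u v : (Fin N → ℤ) → ℝ) (z x : Fin N → ℤ) :
    gradForm (lattice N) (fun y => u (y + z)) (fun y => v (y + z)) x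
      = gradForm (lattice N) u v (x + z) := by
  simp only [gradForm_lattice, add_right_comm x z, sub_add_eq_add_sub]

theorem hasSum_shift {f : (Fin N → ℤ) → ℝ} {a : ℝ} (h : HasSum f a) (e : Fin N → ℤ) :
    HasSum (fun x => f (x - e)) a :=
  (Equiv.hasSum_iff (f := f) (Equiv.subRight e)).2 h

/-- With `A` the product of forward differences and `B x = u x * (v x - v (x + e))`, one has `A x -
B x = u (x + e) * (v (x + e) - v x)`. Translating this by `e` gives the backward term `u x * (v x -
v (x - e))`, so both families have total `∑ A`, with the first counting it twice. -/
theorem hasSum_difference_by_parts (hu : SqSummable u) (hv : SqSummable v) (e : Fin N → ℤ) :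
    ∃ a, HasSum (fun x => (u (x + e) - u x) * (v (x + e) - v x)
        + (u (x - e) - u x) * (v (x - e) - v x)) (a + a)
      ∧ HasSum (fun x => u x * (v x - v (x + e)) + u x * (v x - v (x - e))) a := by
  obtain ⟨a, hA⟩ : Summable fun x => (u (x + e) - u x) * (v (x + e) - v x) :=
    SqSummable.mul ((hu.shift e).sub hu) ((hv.shift e).sub hv)
  obtain ⟨b, hB⟩ : Summable fun x => u x * (v x - v (x + e)) :=
    SqSummable.mul hu (hv.sub (hv.shift e))
  refine ⟨a, ?_, ?_⟩
  · refine (hA.add (hasSum_shift hA e)).congr_fun fun x => ?_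
    simp only [sub_add_cancel]
    ring
  · have := hB.add (hasSum_shift (hA.sub hB) e)
    rw [add_sub_cancel] at this
    refine this.congr_fun fun x => ?_
    simp only [sub_add_cancel]
    ring

theorem summation_by_parts_aux (hu : SqSummable u) (hv : SqSummable v) :
    ∃ a, HasSum (gradForm (lattice N) u v) a
      ∧ HasSum (fun x => u x * -laplacian (lattice N) v x) a := by
  choose a hA hB using fun i : Fin N => hasSum_difference_by_parts hu hv (Pi.single i 1)
  refine ⟨∑ i, a i, ?_, ?_⟩
  · have := (hasSum_sum fun i (_ : i ∈ Finset.univ) => hA i).mul_left (1 / 2)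
    rw [Finset.sum_add_distrib, ← two_mul, ← mul_assoc, one_div, inv_mul_cancel₀ two_ne_zero,
      one_mul] at this
    refine this.congr_fun fun x => ?_
    rw [gradForm_lattice, one_div]
  · refine (hasSum_sum fun i (_ : i ∈ Finset.univ) => hB i).congr_fun fun x => ?_
    rw [laplacian_lattice, ← Finset.sum_neg_distrib, Finset.mul_sum]
    exact Finset.sum_congr rfl fun i _ => by ring

theorem SqSummable.summable_gradForm (hu : SqSummable u) (hv : SqSummable v) :
    Summable (gradForm (lattice N) u v) :=
  (summation_by_parts_aux hu hv).choose_spec.1.summable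

theorem SqSummable.summable_mul_laplacian (hu : SqSummable u) (hv : SqSummable v) :
    Summable fun x => u x * -laplacian (lattice N) v x :=
  (summation_by_parts_aux hu hv).choose_spec.2.summable

/-- Summation by parts on the lattice. -/
theorem gradPair_eq_tsum_laplacian (hu : SqSummable u) (hv : SqSummable v) :
    gradPair u v = ∑' x, u x * -laplacian (lattice N) v x := by
  obtain ⟨a, h1, h2⟩ := summation_by_parts_aux hu hv
  rw [gradPair, h1.tsum_eq, h2.tsum_eq]

theorem gradPair_comm (u v : (Fin N → ℤ) → ℝ) : gradPair u v = gradPair v u :=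
  tsum_congr fun x => gradForm_comm u v x

theorem gradPair_self_nonneg (u : (Fin N → ℤ) → ℝ) : 0 ≤ gradPair u u :=
  tsum_nonneg (gradForm_self_nonneg u)

theorem gradPair_add_left (hu : SqSummable u) (hv : SqSummable v) (hw : SqSummable w) :
    gradPair (u + v) w = gradPair u w + gradPair v w := by
  rw [gradPair, gradPair, gradPair,
    ← (hu.summable_gradForm hw).tsum_add (hv.summable_gradForm hw)]
  exact tsum_congr fun x => gradForm_add_left u v w x

theorem gradPair_smul_left (c : ℝ) (u w : (Fin N → ℤ) → ℝ) :
    gradPair (c • u) w = c * gradPair u w := by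
  rw [gradPair, gradPair, ← tsum_mul_left]
  exact tsum_congr fun x => gradForm_smul_left c u w x

theorem gradPair_add_self (hu : SqSummable u) (hv : SqSummable v) :
    gradPair (u + v) (u + v) = gradPair u u + 2 * gradPair u v + gradPair v v := by
  rw [gradPair_add_left hu hv (hu.add hv), gradPair_comm u, gradPair_comm v,
    gradPair_add_left hu hv hu, gradPair_add_left hu hv hv, gradPair_comm v u]
  ring

theorem gradPair_smul_self (c : ℝ) (u : (Fin N → ℤ) → ℝ) :
    gradPair (c • u) (c • u) = c ^ 2 * gradPair u u := by
  rw [gradPair_smul_left, gradPair_comm, gradPair_smul_left]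
  ring

theorem gradPair_shift (u v : (Fin N → ℤ) → ℝ) (z : Fin N → ℤ) :
    gradPair (fun y => u (y + z)) (fun y => v (y + z)) = gradPair u v := by
  rw [gradPair, gradPair]
  simp only [gradForm_shift]
  exact (Equiv.addRight z).tsum_eq (gradForm (lattice N) u v)

theorem gradPair_abs_le (hu : SqSummable u) :
    gradPair (fun x => |u x|) (fun x => |u x|) ≤ gradPair u u := by
  refine (hu.abs.summable_gradForm hu.abs).tsum_le_tsum (fun x => ?_) (hu.summable_gradForm hu)
  rw [gradForm, gradForm]
  refine mul_le_mul_of_nonneg_left (Finset.sum_le_sum fun y _ => ?_) (by norm_num)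
  rw [← sq, ← sq]
  exact sq_le_sq.2 (abs_abs_sub_abs_le_abs_sub (u y) (u x))

theorem gradPair_single_left (x : Fin N → ℤ) (hv : SqSummable v) :
    gradPair (Pi.single x 1) v = -laplacian (lattice N) v x := by
  rw [gradPair_eq_tsum_laplacian (SqSummable.of_finite_support ?_) hv, tsum_eq_single x]
  · simp
  · intro y hy
    simp [hy]
  · exact (Set.finite_singleton x).subset fun y hy => by
      by_contra h
      exact hy (by simp [show y ≠ x from h])

/-- The gradient energy is at most `4 N` times the mass. -/
theorem gradPair_self_le (hu : SqSummable u) : gradPair u u ≤ 4 * N * mass u := by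
  have hM : HasSum (fun x => u x ^ 2) (mass u) := Summable.hasSum hu
  have hbound : HasSum (fun x => ∑ i : Fin N, (u (x + Pi.single i 1) ^ 2 + u x ^ 2
      + (u (x - Pi.single i 1) ^ 2 + u x ^ 2))) (∑ _i : Fin N, (mass u + mass u
      + (mass u + mass u))) := by
    refine hasSum_sum fun i _ => (HasSum.add ?_ hM).add ((hasSum_shift hM _).add hM)
    simpa using hasSum_shift hM (-Pi.single i 1)
  have hle := hasSum_le (fun x => ?_) (hu.summable_gradForm hu).hasSum hbound
  · refine hle.trans (le_of_eq ?_)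
    simp
    ring
  · rw [gradForm_lattice, Finset.mul_sum]
    refine Finset.sum_le_sum fun i _ => ?_
    nlinarith [sq_nonneg (u (x + Pi.single i 1) + u x), sq_nonneg (u (x - Pi.single i 1) + u x)]

end GradientPairing

/-! ### Evaluation of the extended-real integral. -/

section ExtendedIntegral

variable {α : Type*} {f : α → ℝ}

theorem ofReal_tsum_ne_top_iff {g : α → ℝ} (hg : ∀ x, 0 ≤ g x) :
    ∑' x, ENNReal.ofReal (g x) ≠ ⊤ ↔ Summable g := by
  constructor
  · intro h
    refine (ENNReal.summable_toReal h).congr fun x => ?_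
    rw [ENNReal.toReal_ofReal (hg x)]
  · intro h
    rw [← ENNReal.ofReal_tsum_of_nonneg hg h]
    exact ENNReal.ofReal_ne_top

theorem ofReal_tsum_eq_posPart (f : α → ℝ) :
    ∑' x, ENNReal.ofReal (f x) = ∑' x, ENNReal.ofReal (max (f x) 0) :=
  tsum_congr fun x => by simp [ENNReal.ofReal, Real.toNNReal]

theorem integral_eq_tsum (hf : Summable f) : integral f = ((∑' x, f x : ℝ) : EReal) := by
  have hp : Summable fun x => max (f x) 0 :=
    Summable.of_nonneg_of_le (fun x => le_max_right _ _)
      (fun x => max_le (le_abs_self _) (abs_nonneg _)) hf.abs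
  have hn : Summable fun x => max (-f x) 0 :=
    Summable.of_nonneg_of_le (fun x => le_max_right _ _)
      (fun x => max_le (neg_le_abs _) (abs_nonneg _)) hf.abs
  rw [integral, ofReal_tsum_eq_posPart, ofReal_tsum_eq_posPart (fun x => -f x),
    ← ENNReal.ofReal_tsum_of_nonneg (fun x => le_max_right _ _) hp,
    ← ENNReal.ofReal_tsum_of_nonneg (fun x => le_max_right _ _) hn,
    EReal.coe_ennreal_ofReal, EReal.coe_ennreal_ofReal,
    max_eq_left (tsum_nonneg fun x => le_max_right _ _),
    max_eq_left (tsum_nonneg fun x => le_max_right _ _), ← EReal.coe_sub, ← hp.tsum_sub hn]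
  congr 1
  refine tsum_congr fun x => ?_
  rcases le_total 0 (f x) with h | h
  · rw [max_eq_left h, max_eq_right (by linarith), sub_zero]
  · rw [max_eq_right h, max_eq_left (by linarith)]; ring

/-- If the positive part is dominated by a summable function but `f` is not summable, then the
extended integral is `-∞`. -/
theorem integral_eq_bot {g : α → ℝ} (hg : Summable g) (hg0 : ∀ x, 0 ≤ g x)
    (hfg : ∀ x, f x ≤ g x) (hf : ¬ Summable f) : integral f = ⊥ := by
  have hp : Summable fun x => max (f x) 0 :=
    Summable.of_nonneg_of_le (fun x => le_max_right _ _) (fun x => max_le (hfg x) (hg0 x)) hg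
  have hn : ∑' x, ENNReal.ofReal (-f x) = ⊤ := by
    rw [ofReal_tsum_eq_posPart (fun x => -f x)]
    by_contra h
    have hn := (ofReal_tsum_ne_top_iff fun x => le_max_right _ _).1 h
    refine hf ((hp.sub hn).congr fun x => ?_)
    rcases le_total 0 (f x) with h | h
    · rw [max_eq_left h, max_eq_right (by linarith), sub_zero]
    · rw [max_eq_right h, max_eq_left (by linarith)]; ring
  rw [integral, hn, ofReal_tsum_eq_posPart,
    ← ENNReal.ofReal_tsum_of_nonneg (fun x => le_max_right _ _) hp, EReal.coe_ennreal_ofReal,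
    EReal.coe_ennreal_top, sub_eq_add_neg, EReal.neg_top, EReal.add_bot]

end ExtendedIntegral

/-- Summability of `u² log u²`. -/
def LogSummable {α : Type*} (u : α → ℝ) : Prop :=
  Summable fun x => u x ^ 2 * Real.log (u x ^ 2)

/-! ### One-sided control of the logarithmic term. -/

section LogTerm

variable {α : Type*} {u : α → ℝ}

/-- This is `log t ≤ t - 1` together with `u x ^ 2 ≤ mass u`. It dominates the positive part of `u²
log u²`, so failure of summability can only make the integral `-∞`. -/
theorem SqSummable.sq_mul_log_le (hu : SqSummable u) (x : α) :
    u x ^ 2 * Real.log (u x ^ 2) ≤ mass u * u x ^ 2 := by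
  rcases eq_or_ne (u x) 0 with h | h
  · simp [h]
  · have h1 := Real.log_le_sub_one_of_pos (pow_pos (abs_pos.2 h) 2)
    rw [sq_abs] at h1
    nlinarith [hu.sq_le_mass x, sq_nonneg (u x)]

theorem SqSummable.integral_log_eq_bot (hu : SqSummable u) (h : ¬ LogSummable u) :
    integral (fun x => u x ^ 2 * Real.log (u x ^ 2)) = ⊥ :=
  integral_eq_bot (Summable.mul_left (mass u) hu)
    (fun _ => mul_nonneg (mass_nonneg u) (sq_nonneg _)) hu.sq_mul_log_le h

end LogTerm

/-! ### Sums over a finite set and its complement. -/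

section Cutoff

variable {α : Type*} {f : α → ℝ} {a : ℝ}

theorem hasSum_indicator_finset (f : α → ℝ) (s : Finset α) :
    HasSum ((s : Set α).indicator f) (∑ x ∈ s, f x) := by
  have h : HasSum ((s : Set α).indicator f) (∑ x ∈ s, (s : Set α).indicator f x) :=
    hasSum_sum_of_ne_finset_zero fun x hx => Set.indicator_of_notMem (by simpa using hx) f
  rwa [Finset.sum_congr rfl fun x hx => Set.indicator_of_mem (Finset.mem_coe.2 hx) f] at h

theorem hasSum_indicator_compl (hf : HasSum f a) (s : Finset α) :
    HasSum ((s : Set α)ᶜ.indicator f) (a - ∑ x ∈ s, f x) := by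
  refine (hf.sub (hasSum_indicator_finset f s)).congr_fun fun x => ?_
  rw [Set.indicator_compl]
  rfl

end Cutoff

/-! ### The variational objects in terms of `ℓ²` sums. -/

section Energy

variable {N : ℕ} {V u : (Fin N → ℤ) → ℝ}

theorem h1NormSq_eq_ofReal (hu : SqSummable u) :
    h1NormSq (lattice N) u = ENNReal.ofReal (gradPair u u + mass u) := by
  rw [h1NormSq, ← ENNReal.ofReal_tsum_of_nonneg (gradForm_self_nonneg u) (hu.summable_gradForm hu),
    ← ENNReal.ofReal_tsum_of_nonneg (fun x => sq_nonneg (u x)) hu,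
    ← gradPair, ← mass, ← ENNReal.ofReal_add (gradPair_self_nonneg u) (mass_nonneg u)]

/-- The gradient energy is at most `4 N` times the mass, so the `H¹` and `ℓ²` norms are equivalent
and truncations to finite sets converge in `H¹`. -/
theorem mem_H1_iff : u ∈ H1 (lattice N) ↔ SqSummable u := by
  classical
  constructor
  · intro h
    obtain ⟨φ, hφ, hlt⟩ := h 1 one_pos
    have h1 : SqSummable (u - φ) :=
      (ofReal_tsum_ne_top_iff (fun x => sq_nonneg ((u - φ) x))).1
        ((le_add_self.trans hlt.le).trans_lt ENNReal.one_lt_top).ne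
    simpa using h1.add (SqSummable.of_finite_support hφ)
  · intro hu ε hε
    have hlim : Tendsto (fun s : Finset (Fin N → ℤ) =>
        ENNReal.ofReal ((4 * N + 1) * (mass u - ∑ x ∈ s, u x ^ 2))) atTop (𝓝 0) := by
      have h1 : Tendsto (fun s : Finset (Fin N → ℤ) => ∑ x ∈ s, u x ^ 2) atTop (𝓝 (mass u)) :=
        Summable.hasSum hu
      have h2 := ENNReal.tendsto_ofReal ((h1.const_sub (mass u)).const_mul (4 * (N : ℝ) + 1))
      simpa using h2
    obtain ⟨s, hs⟩ := (hlim.eventually (gt_mem_nhds hε)).exists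
    refine ⟨(s : Set (Fin N → ℤ)).indicator u,
      s.finite_toSet.subset Set.support_indicator_subset, lt_of_le_of_lt ?_ hs⟩
    have hv : SqSummable (u - (s : Set (Fin N → ℤ)).indicator u) := hu.sub (hu.indicator _)
    rw [h1NormSq_eq_ofReal hv]
    have hm : mass (u - (s : Set (Fin N → ℤ)).indicator u) = mass u - ∑ x ∈ s, u x ^ 2 := by
      refine HasSum.tsum_eq ((hasSum_indicator_compl (Summable.hasSum hu) s).congr_fun fun x => ?_)
      by_cases hx : x ∈ s <;> simp [hx]
    rw [← hm]
    refine ENNReal.ofReal_le_ofReal ?_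
    linarith [gradPair_self_le hv]

theorem mem_X_iff (hV : ∃ C, ∀ x, V x ≤ C) : u ∈ X (lattice N) V ↔ SqSummable u := by
  refine ⟨fun h => mem_H1_iff.1 h.1, fun hu => ⟨mem_H1_iff.2 hu, ?_⟩⟩
  obtain ⟨C, hC⟩ := hV
  refine lt_of_le_of_lt (ENNReal.tsum_le_tsum fun x =>
    ENNReal.ofReal_le_ofReal (show _ ≤ (|C| + 1) * u x ^ 2 from ?_)) (lt_top_iff_ne_top.2
    ((ofReal_tsum_ne_top_iff fun x => by positivity).2 (Summable.mul_left _ hu)))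
  exact mul_le_mul_of_nonneg_right (by linarith [hC x, le_abs_self C]) (sq_nonneg _)

/-- `⟨J'(u), u⟩` as a real number. -/
noncomputable def action (V u : (Fin N → ℤ) → ℝ) : ℝ :=
  gradPair u u + ∑' x, V x * u x ^ 2 - ∑' x, u x ^ 2 * Real.log (u x ^ 2)

theorem SqSummable.summable_potential (hVb : ∃ C, ∀ x, |V x| ≤ C) (hu : SqSummable u) :
    Summable fun x => V x * u x ^ 2 := by
  obtain ⟨C, hC⟩ := hVb
  refine Summable.of_norm_bounded (Summable.mul_left C hu) fun x => ?_
  rw [norm_mul, Real.norm_eq_abs, Real.norm_eq_abs, abs_of_nonneg (sq_nonneg (u x))]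
  exact mul_le_mul_of_nonneg_right (hC x) (sq_nonneg _)

theorem hasSum_energy_density (hVb : ∃ C, ∀ x, |V x| ≤ C) (hu : SqSummable u) :
    HasSum (fun x => gradForm (lattice N) u u x + (V x + 1) * u x ^ 2)
      (gradPair u u + ∑' x, V x * u x ^ 2 + mass u) := by
  refine (((hu.summable_gradForm hu).hasSum.add (hu.summable_potential hVb).hasSum).add
    (Summable.hasSum hu)).congr_fun fun x => ?_
  ring

theorem J_eq_of_logSummable (hVb : ∃ C, ∀ x, |V x| ≤ C) (hu : SqSummable u)
    (hl : LogSummable u) :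
    J (lattice N) V u = (((action V u + mass u) / 2 : ℝ) : EReal) := by
  have h := hasSum_energy_density hVb hu
  rw [J, integral_eq_tsum h.summable, integral_eq_tsum hl, h.tsum_eq, ← EReal.coe_mul,
    ← EReal.coe_mul, ← EReal.coe_sub, action]
  congr 1
  ring

theorem J_eq_top (hVb : ∃ C, ∀ x, |V x| ≤ C) (hu : SqSummable u) (hl : ¬ LogSummable u) :
    J (lattice N) V u = ⊤ := by
  have h := hasSum_energy_density hVb hu
  rw [J, integral_eq_tsum h.summable, hu.integral_log_eq_bot hl,
    EReal.coe_mul_bot_of_pos (by norm_num), ← EReal.coe_mul, EReal.coe_sub_bot]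

theorem mem_effDomain_iff (hVb : ∃ C, ∀ x, |V x| ≤ C) :
    u ∈ effDomain (lattice N) V ↔ SqSummable u ∧ LogSummable u := by
  have hV : ∃ C, ∀ x, V x ≤ C := hVb.imp fun C h x => (le_abs_self _).trans (h x)
  rw [effDomain, Set.mem_ofPred_eq, mem_X_iff hV]
  refine and_congr_right fun hu => ?_
  by_cases hl : LogSummable u
  · simp [hl, J_eq_of_logSummable hVb hu hl, EReal.coe_lt_top]
  · simp [hl, J_eq_top hVb hu hl]

theorem derivJ_self (hVb : ∃ C, ∀ x, |V x| ≤ C) (hu : SqSummable u) (hl : LogSummable u) :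
    derivJ (lattice N) V u u = ((action V u : ℝ) : EReal) := by
  have h : HasSum (fun x => gradForm (lattice N) u u x + V x * u x * u x)
      (gradPair u u + ∑' x, V x * u x ^ 2) :=
    ((hu.summable_gradForm hu).hasSum.add (hu.summable_potential hVb).hasSum).congr_fun
      fun x => by ring
  have hl' : HasSum (fun x => u x * u x * Real.log (u x ^ 2))
      (∑' x, u x ^ 2 * Real.log (u x ^ 2)) :=
    (Summable.hasSum hl).congr_fun fun x => by ring
  rw [derivJ, integral_eq_tsum h.summable, integral_eq_tsum hl'.summable, h.tsum_eq, hl'.tsum_eq,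
    ← EReal.coe_sub, action]

theorem mem_nehari_iff (hVb : ∃ C, ∀ x, |V x| ≤ C) :
    u ∈ nehari (lattice N) V ↔ SqSummable u ∧ LogSummable u ∧ u ≠ 0 ∧ action V u = 0 := by
  rw [nehari, Set.mem_ofPred_eq, mem_effDomain_iff hVb, and_assoc]
  refine and_congr_right fun hu => and_congr_right fun hl => and_congr_right fun _ => ?_
  rw [derivJ_self hVb hu hl, EReal.coe_eq_zero]

theorem xNormSq_eq_ofReal (hVb : ∃ C, ∀ x, |V x| ≤ C) (hV1 : ∀ x, -1 ≤ V x)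
    (hu : SqSummable u) :
    xNormSq (lattice N) V u
      = ENNReal.ofReal (gradPair u u + ∑' x, V x * u x ^ 2 + mass u) := by
  have h := hasSum_energy_density hVb hu
  rw [xNormSq, ← ENNReal.ofReal_tsum_of_nonneg (fun x => ?_) h.summable, h.tsum_eq]
  exact add_nonneg (gradForm_self_nonneg u x)
    (mul_nonneg (by linarith [hV1 x]) (sq_nonneg _))

end Energy

/-! ### Stability of log-summability. -/

section LogSummable

variable {α : Type*} {u : α → ℝ}

theorem LogSummable.indicator (hu : LogSummable u) (s : Set α) : LogSummable (s.indicator u) := by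
  refine (Summable.indicator hu s).congr fun x => ?_
  by_cases hx : x ∈ s <;> simp [hx]

theorem LogSummable.comp_equiv (hu : LogSummable u) (e : α ≃ α) : LogSummable (u ∘ e) :=
  (Equiv.summable_iff (f := fun x => u x ^ 2 * Real.log (u x ^ 2)) e).2 hu

theorem LogSummable.abs (hu : LogSummable u) : LogSummable fun x => |u x| := by
  simpa [LogSummable, sq_abs] using hu

theorem LogSummable.of_finite_support (hu : (Function.support u).Finite) : LogSummable u :=
  summable_of_hasFiniteSupport (hu.subset fun x hx h => hx (by simp [h]))

theorem hasSum_log_smul (hu : SqSummable u) (hl : LogSummable u) {c : ℝ} (hc : c ≠ 0) :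
    HasSum (fun x => (c • u) x ^ 2 * Real.log ((c • u) x ^ 2))
      (c ^ 2 * (∑' x, u x ^ 2 * Real.log (u x ^ 2) + Real.log (c ^ 2) * mass u)) := by
  refine (((Summable.hasSum hl).add ((Summable.hasSum hu).mul_left
    (Real.log (c ^ 2)))).mul_left (c ^ 2)).congr_fun fun x => ?_
  simp only [Pi.smul_apply, smul_eq_mul, mul_pow]
  rcases eq_or_ne (u x) 0 with h | h
  · simp [h]
  · rw [Real.log_mul (pow_ne_zero 2 hc) (pow_ne_zero 2 h)]
    ring

theorem SqSummable.sq_mul_log_nonpos (hu : SqSummable u) (hm : mass u ≤ 1) (x : α) :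
    u x ^ 2 * Real.log (u x ^ 2) ≤ 0 :=
  mul_nonpos_of_nonneg_of_nonpos (sq_nonneg _)
    (Real.log_nonpos (sq_nonneg _) ((hu.sq_le_mass x).trans hm))

end LogSummable

/-! ### Scaling, lower bounds and cutting of the action. -/

section Action

variable {N : ℕ} {V u : (Fin N → ℤ) → ℝ}

theorem potential_smul (c : ℝ) (V u : (Fin N → ℤ) → ℝ) :
    ∑' x, V x * (c • u) x ^ 2 = c ^ 2 * ∑' x, V x * u x ^ 2 := by
  rw [← tsum_mul_left]
  exact tsum_congr fun x => by simp only [Pi.smul_apply, smul_eq_mul]; ring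

theorem action_smul (hu : SqSummable u) (hl : LogSummable u) {c : ℝ} (hc : c ≠ 0) :
    action V (c • u) = c ^ 2 * (action V u - Real.log (c ^ 2) * mass u) := by
  rw [action, action, gradPair_smul_self, potential_smul, (hasSum_log_smul hu hl hc).tsum_eq]
  ring

theorem action_shift {z : Fin N → ℤ} (hz : ∀ x, V (x + z) = V x) (u : (Fin N → ℤ) → ℝ) :
    action V (fun x => u (x + z)) = action V u := by
  rw [action, action, gradPair_shift]
  congr 1
  · congr 1
    rw [← (Equiv.addRight z).tsum_eq fun x => V x * u x ^ 2]
    exact tsum_congr fun x => by simp [hz]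
  · exact (Equiv.addRight z).tsum_eq fun x => u x ^ 2 * Real.log (u x ^ 2)

theorem action_abs_le (hu : SqSummable u) : action V (fun x => |u x|) ≤ action V u := by
  simp only [action, sq_abs]
  linarith [gradPair_abs_le hu]

theorem neg_mass_le_potential (hVb : ∃ C, ∀ x, |V x| ≤ C) (hV1 : ∀ x, -1 ≤ V x)
    (hu : SqSummable u) : -mass u ≤ ∑' x, V x * u x ^ 2 := by
  rw [mass, ← tsum_neg]
  refine (Summable.neg hu).tsum_le_tsum (fun x => ?_) (hu.summable_potential hVb)
  nlinarith [hV1 x, sq_nonneg (u x)]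

theorem neg_mass_sub_log_le_action (hVb : ∃ C, ∀ x, |V x| ≤ C) (hV1 : ∀ x, -1 ≤ V x)
    (hu : SqSummable u) :
    -mass u - ∑' x, u x ^ 2 * Real.log (u x ^ 2) ≤ action V u := by
  rw [action]
  linarith [neg_mass_le_potential hVb hV1 hu, gradPair_self_nonneg u]

theorem neg_one_le_action (hVb : ∃ C, ∀ x, |V x| ≤ C) (hV1 : ∀ x, -1 ≤ V x)
    (hu : SqSummable u) (hm : mass u = 1) : -1 ≤ action V u := by
  have h : ∑' x, u x ^ 2 * Real.log (u x ^ 2) ≤ 0 := tsum_nonpos (hu.sq_mul_log_nonpos hm.le)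
  linarith [neg_mass_sub_log_le_action hVb hV1 hu]

/-- The values of the action on the unit sphere of `ℓ²`. -/
def sphereValues (V : (Fin N → ℤ) → ℝ) : Set ℝ :=
  {a | ∃ u, SqSummable u ∧ LogSummable u ∧ mass u = 1 ∧ action V u = a}

theorem sphereValues_nonempty (V : (Fin N → ℤ) → ℝ) : (sphereValues V).Nonempty := by
  classical
  have h : (Function.support (Pi.single 0 1 : (Fin N → ℤ) → ℝ)).Finite :=
    (Set.finite_singleton 0).subset Pi.support_single_subset
  refine ⟨_, Pi.single 0 1, .of_finite_support h, .of_finite_support h, ?_, rfl⟩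
  rw [mass, tsum_eq_single 0 fun x hx => by simp [hx]]
  simp

theorem sphereValues_bddBelow (hVb : ∃ C, ∀ x, |V x| ≤ C) (hV1 : ∀ x, -1 ≤ V x) :
    BddBelow (sphereValues V) :=
  ⟨-1, fun _ ⟨_, hu, _, hm, h⟩ => h ▸ neg_one_le_action hVb hV1 hu hm⟩

/-- The logarithmic Sobolev type inequality given by the infimum of the action on the sphere. -/
theorem mass_mul_le_action (hVb : ∃ C, ∀ x, |V x| ≤ C) (hV1 : ∀ x, -1 ≤ V x)
    (hu : SqSummable u) (hl : LogSummable u) :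
    mass u * (sInf (sphereValues V) - Real.log (mass u)) ≤ action V u := by
  rcases eq_or_ne u 0 with rfl | h0
  · simp [mass, action, gradPair, gradForm]
  have hm := hu.mass_pos h0
  have hc : (√(mass u))⁻¹ ≠ 0 := inv_ne_zero (Real.sqrt_ne_zero'.2 hm)
  have hc2 : (√(mass u))⁻¹ ^ 2 = (mass u)⁻¹ := by rw [inv_pow, Real.sq_sqrt hm.le]
  have h := csInf_le (sphereValues_bddBelow hVb hV1)
    ⟨(√(mass u))⁻¹ • u, hu.smul _, (hasSum_log_smul hu hl hc).summable,
      by rw [mass_smul, hc2, inv_mul_cancel₀ hm.ne'], rfl⟩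
  rw [action_smul hu hl hc, hc2, Real.log_inv, inv_mul_eq_div, le_div_iff₀ hm] at h
  linarith

theorem mass_indicator_finset (u : (Fin N → ℤ) → ℝ) (s : Finset (Fin N → ℤ)) :
    mass ((s : Set (Fin N → ℤ)).indicator u) = ∑ x ∈ s, u x ^ 2 := by
  refine HasSum.tsum_eq ((hasSum_indicator_finset _ s).congr_fun fun x => ?_)
  by_cases hx : x ∈ s <;> simp [hx]

theorem mass_indicator_compl (hu : SqSummable u) (s : Finset (Fin N → ℤ)) :
    mass ((s : Set (Fin N → ℤ))ᶜ.indicator u) = mass u - ∑ x ∈ s, u x ^ 2 := by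
  refine HasSum.tsum_eq ((hasSum_indicator_compl (Summable.hasSum hu) s).congr_fun fun x => ?_)
  by_cases hx : x ∈ s <;> simp [hx]

/-- Cutting `u` along a finite set splits the action up to the energy of the cut edges. -/
theorem action_eq_cut (hVb : ∃ C, ∀ x, |V x| ≤ C) (hu : SqSummable u) (hl : LogSummable u)
    (s : Set (Fin N → ℤ)) :
    action V u = action V (s.indicator u) + action V (sᶜ.indicator u)
      + 2 * gradPair (s.indicator u) (sᶜ.indicator u) := by
  have h1 := gradPair_add_self (hu.indicator s) (hu.indicator sᶜ)
  rw [Set.indicator_self_add_compl] at h1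
  have h2 : ∑' x, V x * u x ^ 2
      = ∑' x, V x * s.indicator u x ^ 2 + ∑' x, V x * sᶜ.indicator u x ^ 2 := by
    rw [← ((hu.indicator s).summable_potential hVb).tsum_add
      ((hu.indicator sᶜ).summable_potential hVb)]
    exact tsum_congr fun x => by by_cases hx : x ∈ s <;> simp [hx]
  have h3 : ∑' x, u x ^ 2 * Real.log (u x ^ 2)
      = ∑' x, s.indicator u x ^ 2 * Real.log (s.indicator u x ^ 2)
        + ∑' x, sᶜ.indicator u x ^ 2 * Real.log (sᶜ.indicator u x ^ 2) := by
    rw [← Summable.tsum_add (hl.indicator s) (hl.indicator sᶜ)]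
    exact tsum_congr fun x => by by_cases hx : x ∈ s <;> simp [hx]
  rw [action, action, action, h1, h2, h3]
  ring

/-- The right side involves only finitely many values of `u`, so the energy of the cut edges passes
to pointwise limits. -/
theorem gradPair_cut_eq_sum (hu : SqSummable u) (s : Finset (Fin N → ℤ)) :
    gradPair ((s : Set (Fin N → ℤ)).indicator u) ((s : Set (Fin N → ℤ))ᶜ.indicator u)
      = ∑ x ∈ s, u x * -laplacian (lattice N) ((s : Set (Fin N → ℤ))ᶜ.indicator u) x := by
  rw [gradPair_eq_tsum_laplacian (hu.indicator _) (hu.indicator _)]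
  refine HasSum.tsum_eq ((hasSum_indicator_finset _ s).congr_fun fun x => ?_)
  by_cases hx : x ∈ s <;> simp [hx]

/-- Writing the inner piece as `u` minus the outer piece turns the pairing into the tail of a
convergent series minus the gradient energy of the outer piece; the latter is at most `4 N` times
the mass outside `s`. -/
theorem tendsto_gradPair_cut (hu : SqSummable u) :
    Tendsto (fun s : Finset (Fin N → ℤ) => gradPair ((s : Set (Fin N → ℤ)).indicator u)
      ((s : Set (Fin N → ℤ))ᶜ.indicator u)) atTop (𝓝 0) := by
  have hs := (hu.summable_mul_laplacian hu).hasSum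
  have h1 : ∀ s : Finset (Fin N → ℤ), gradPair ((s : Set (Fin N → ℤ)).indicator u)
      ((s : Set (Fin N → ℤ))ᶜ.indicator u)
      = (∑' x, u x * -laplacian (lattice N) u x - ∑ x ∈ s, u x * -laplacian (lattice N) u x)
        - gradPair ((s : Set (Fin N → ℤ))ᶜ.indicator u) ((s : Set (Fin N → ℤ))ᶜ.indicator u) := by
    intro s
    have h2 : gradPair ((s : Set (Fin N → ℤ))ᶜ.indicator u) u
        = ∑' x, u x * -laplacian (lattice N) u x
          - ∑ x ∈ s, u x * -laplacian (lattice N) u x := by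
      rw [gradPair_eq_tsum_laplacian (hu.indicator _) hu]
      refine HasSum.tsum_eq ((hasSum_indicator_compl hs s).congr_fun fun x => ?_)
      by_cases hx : x ∈ s <;> simp [hx]
    have h3 := gradPair_add_left (hu.indicator (s : Set (Fin N → ℤ)))
      (hu.indicator (s : Set (Fin N → ℤ))ᶜ) (hu.indicator (s : Set (Fin N → ℤ))ᶜ)
    rw [Set.indicator_self_add_compl, gradPair_comm, h2] at h3
    linarith
  have h4 : Tendsto (fun s : Finset (Fin N → ℤ) => gradPair
      ((s : Set (Fin N → ℤ))ᶜ.indicator u) ((s : Set (Fin N → ℤ))ᶜ.indicator u))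
      atTop (𝓝 0) := by
    have h5 : Tendsto (fun s : Finset (Fin N → ℤ) => 4 * N * (mass u - ∑ x ∈ s, u x ^ 2))
        atTop (𝓝 0) := by
      have h6 : Tendsto (fun s : Finset (Fin N → ℤ) => ∑ x ∈ s, u x ^ 2) atTop (𝓝 (mass u)) :=
        Summable.hasSum hu
      simpa using (h6.const_sub (mass u)).const_mul (4 * (N : ℝ))
    refine squeeze_zero (fun s => gradPair_self_nonneg _) (fun s => ?_) h5
    rw [← mass_indicator_compl hu s]
    exact gradPair_self_le (hu.indicator _)
  have h7 : Tendsto (fun s : Finset (Fin N → ℤ) => ∑ x ∈ s, u x * -laplacian (lattice N) u x)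
      atTop (𝓝 (∑' x, u x * -laplacian (lattice N) u x)) := hs
  simpa only [h1, sub_self] using (h7.const_sub
    (∑' x, u x * -laplacian (lattice N) u x)).sub h4

end Action

/-! ### Existence of a minimizer on the unit sphere. -/

section Minimizer

variable {N : ℕ} {V u : (Fin N → ℤ) → ℝ}

/-- A function on the unit sphere with bounded action does not vanish uniformly. -/
theorem exists_sq_ge_of_action_le (hVb : ∃ C, ∀ x, |V x| ≤ C) (hV1 : ∀ x, -1 ≤ V x)
    (hu : SqSummable u) (hl : LogSummable u) (hm : mass u = 1) {K : ℝ} (hK : action V u ≤ K) :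
    ∃ x, Real.exp (-(K + 2)) ≤ u x ^ 2 := by
  by_contra! hcon
  -- If `u² < exp (-(K + 2))` everywhere, the action is at least `-1 + (K + 2) = K + 1`, which
  -- contradicts `hK`.
  have h : ∑' x, u x ^ 2 * Real.log (u x ^ 2) ≤ -(K + 2) * mass u := by
    rw [mass, ← tsum_mul_left]
    refine Summable.tsum_le_tsum (fun x => ?_) hl (Summable.mul_left _ hu)
    rcases eq_or_ne (u x) 0 with h | h
    · simp [h]
    · have hpos : 0 < u x ^ 2 := by positivity
      have := (Real.log_lt_iff_lt_exp hpos).2 (hcon x)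
      nlinarith
  rw [hm, mul_one] at h
  linarith [neg_mass_sub_log_le_action hVb hV1 hu]

/-- After a translation by a period, such a function carries mass in the fundamental box. -/
theorem exists_translate_mass_box {T : ℕ} (hT : 0 < T) (hper : IsPeriodic T V)
    (hVb : ∃ C, ∀ x, |V x| ≤ C) (hV1 : ∀ x, -1 ≤ V x)
    (hu : SqSummable u) (hl : LogSummable u) (hm : mass u = 1) {K : ℝ} (hK : action V u ≤ K) :
    ∃ v, SqSummable v ∧ LogSummable v ∧ mass v = 1 ∧ action V v = action V u ∧
      Real.exp (-(K + 2)) ≤ ∑ y ∈ fundamentalBox N T, v y ^ 2 := by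
  obtain ⟨x, hx⟩ := exists_sq_ge_of_action_le hVb hV1 hu hl hm hK
  obtain ⟨z, y, hy, rfl⟩ := exists_mem_fundamentalBox hT x
  refine ⟨fun x => u (x + (T : ℤ) • z), hu.shift _, hl.comp_equiv (Equiv.addRight _), ?_,
    action_shift (fun x => hper.add_smul x z) u, hx.trans ?_⟩
  · exact ((Equiv.addRight ((T : ℤ) • z)).tsum_eq fun x => u x ^ 2).trans hm
  · exact Finset.single_le_sum (f := fun y => u (y + (T : ℤ) • z) ^ 2)
      (fun _ _ => sq_nonneg _) hy

/-- Fatou's lemma for counting measure, proved through finite partial sums. -/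
theorem summable_and_tsum_le_of_tendsto {α : Type*} {g : ℕ → α → ℝ} {f : α → ℝ} {a : ℕ → ℝ}
    {b : ℝ} (hg0 : ∀ n x, 0 ≤ g n x) (hg : ∀ n, HasSum (g n) (a n))
    (hlim : ∀ x, Tendsto (fun n => g n x) atTop (𝓝 (f x))) (ha : Tendsto a atTop (𝓝 b)) :
    Summable f ∧ ∑' x, f x ≤ b := by
  have hf0 : ∀ x, 0 ≤ f x := fun x => ge_of_tendsto' (hlim x) fun n => hg0 n x
  have hle : ∀ s : Finset α, ∑ x ∈ s, f x ≤ b := fun s =>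
    le_of_tendsto_of_tendsto' (tendsto_finsetSum s fun x _ => hlim x) ha fun n =>
      sum_le_hasSum s (fun x _ => hg0 n x) (hg n)
  exact ⟨summable_of_sum_le hf0 hle, Real.tsum_le_of_sum_le hf0 hle⟩

theorem mul_log_neg {m : ℝ} (h0 : 0 < m) (h1 : m < 1) : m * Real.log m < 0 :=
  mul_neg_of_pos_of_neg h0 (Real.log_neg h0 h1)

theorem tendsto_mul_sub_log {ι : Type*} {l : Filter ι} {f : ι → ℝ} {m : ℝ}
    (hf : Tendsto f l (𝓝 m)) (d : ℝ) :
    Tendsto (fun n => f n * (d - Real.log (f n))) l (𝓝 (m * (d - Real.log m))) := by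
  simp only [mul_sub]
  exact (hf.mul_const d).sub ((Real.continuous_mul_log.tendsto m).comp hf)

/-- A nonzero pointwise limit of a minimizing sequence on the sphere loses no mass. -/
theorem mass_eq_one_of_minimizing (hVb : ∃ C, ∀ x, |V x| ≤ C) (hV1 : ∀ x, -1 ≤ V x)
    {w : ℕ → (Fin N → ℤ) → ℝ} (hw : ∀ n, SqSummable (w n)) (hwl : ∀ n, LogSummable (w n))
    (hwm : ∀ n, mass (w n) = 1)
    (hwa : Tendsto (fun n => action V (w n)) atTop (𝓝 (sInf (sphereValues V))))
    (hlim : ∀ x, Tendsto (fun n => w n x) atTop (𝓝 (u x))) (hu : SqSummable u) (h0 : u ≠ 0)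
    (hm : mass u ≤ 1) : mass u = 1 := by
  set d := sInf (sphereValues V)
  -- For a finite cut, apply the sphere inequality to each piece of `w n`. Since the total mass is
  -- `1`, every quantity depends on finitely many values, so pointwise convergence suffices.
  have hcut : ∀ s : Finset (Fin N → ℤ),
      (∑ x ∈ s, u x ^ 2) * (d - Real.log (∑ x ∈ s, u x ^ 2))
        + (1 - ∑ x ∈ s, u x ^ 2) * (d - Real.log (1 - ∑ x ∈ s, u x ^ 2))
        + 2 * gradPair ((s : Set (Fin N → ℤ)).indicator u)
          ((s : Set (Fin N → ℤ))ᶜ.indicator u) ≤ d := by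
    intro s
    have hle : ∀ n, (∑ x ∈ s, w n x ^ 2) * (d - Real.log (∑ x ∈ s, w n x ^ 2))
        + (1 - ∑ x ∈ s, w n x ^ 2) * (d - Real.log (1 - ∑ x ∈ s, w n x ^ 2))
        + 2 * gradPair ((s : Set (Fin N → ℤ)).indicator (w n))
          ((s : Set (Fin N → ℤ))ᶜ.indicator (w n)) ≤ action V (w n) := by
      intro n
      have h1 := mass_mul_le_action hVb hV1 ((hw n).indicator s) ((hwl n).indicator s)
      have h2 := mass_mul_le_action hVb hV1 ((hw n).indicator sᶜ) ((hwl n).indicator sᶜ)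
      rw [mass_indicator_finset] at h1
      rw [mass_indicator_compl (hw n), hwm] at h2
      rw [action_eq_cut hVb (hw n) (hwl n) s]
      linarith
    refine le_of_tendsto_of_tendsto' ?_ hwa hle
    have hsum : Tendsto (fun n => ∑ x ∈ s, w n x ^ 2) atTop (𝓝 (∑ x ∈ s, u x ^ 2)) :=
      tendsto_finsetSum s fun x _ => (hlim x).pow 2
    have hgrad : Tendsto (fun n => gradPair ((s : Set (Fin N → ℤ)).indicator (w n))
        ((s : Set (Fin N → ℤ))ᶜ.indicator (w n))) atTop
        (𝓝 (gradPair ((s : Set (Fin N → ℤ)).indicator u)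
          ((s : Set (Fin N → ℤ))ᶜ.indicator u))) := by
      rw [gradPair_cut_eq_sum hu]
      simp only [gradPair_cut_eq_sum (hw _), laplacian]
      have hind : ∀ x, Tendsto (fun n => (s : Set (Fin N → ℤ))ᶜ.indicator (w n) x) atTop
          (𝓝 ((s : Set (Fin N → ℤ))ᶜ.indicator u x)) := by
        intro x
        by_cases hx : x ∈ s
        · simp [hx]
        · simpa [hx] using hlim x
      exact tendsto_finsetSum s fun x _ => (hlim x).mul
        (tendsto_finsetSum _ fun y _ => (hind y).sub (hind x)).neg
    exact ((tendsto_mul_sub_log hsum d).add (tendsto_mul_sub_log (hsum.const_sub 1) d)).add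
      (hgrad.const_mul 2)
  have hlim2 : mass u * (d - Real.log (mass u))
      + (1 - mass u) * (d - Real.log (1 - mass u)) + 2 * 0 ≤ d := by
    refine le_of_tendsto' (?_ : Tendsto _ atTop (𝓝 _)) hcut
    have hsum : Tendsto (fun s : Finset (Fin N → ℤ) => ∑ x ∈ s, u x ^ 2) atTop (𝓝 (mass u)) :=
      Summable.hasSum hu
    exact ((tendsto_mul_sub_log hsum d).add (tendsto_mul_sub_log (hsum.const_sub 1) d)).add
      ((tendsto_gradPair_cut hu).const_mul 2)
  -- The terms in `d` add up to `d`, so `hlim2` says `m log m + (1 - m) log (1 - m) ≥ 0` for `m =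
  -- mass u`, impossible when `0 < m < 1`.
  by_contra hne
  have hpos := hu.mass_pos h0
  have hlt : mass u < 1 := lt_of_le_of_ne hm hne
  have h1 := mul_log_neg hpos hlt
  have h2 := mul_log_neg (sub_pos.2 hlt) (by linarith : 1 - mass u < 1)
  linarith

/-- Minimizing functions, translated to keep a fixed amount of mass in the fundamental box, lie in
the compact product of intervals `[-1, 1]`. A pointwise limit is nonzero, so it keeps all the mass,
and Fatou's lemma bounds its action. -/
theorem exists_action_minimizer {T : ℕ} (hT : 0 < T) (hper : IsPeriodic T V)
    (hVb : ∃ C, ∀ x, |V x| ≤ C) (hV1 : ∀ x, -1 ≤ V x) :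
    ∃ u, SqSummable u ∧ LogSummable u ∧ mass u = 1 ∧ action V u = sInf (sphereValues V) := by
  obtain ⟨a, hanti, ha, hmem⟩ := exists_seq_tendsto_sInf (sphereValues_nonempty V)
    (sphereValues_bddBelow hVb hV1)
  have htrans : ∀ n, ∃ v, SqSummable v ∧ LogSummable v ∧ mass v = 1 ∧ action V v = a n ∧
      Real.exp (-(a 0 + 2)) ≤ ∑ y ∈ fundamentalBox N T, v y ^ 2 := by
    intro n
    obtain ⟨u, hu, hl, hm, hn⟩ := hmem n
    obtain ⟨v, h1, h2, h3, h4, h5⟩ := exists_translate_mass_box hT hper hVb hV1 hu hl hm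
      (K := a 0) (hn ▸ hanti (Nat.zero_le n))
    exact ⟨v, h1, h2, h3, h4.trans hn, h5⟩
  choose v hv hvl hvm hva hvb using htrans
  have hbound : ∀ n, v n ∈ Set.univ.pi fun _ : Fin N → ℤ => Set.Icc (-1 : ℝ) 1 := by
    intro n x _
    exact abs_le.1 ((sq_le_one_iff_abs_le_one _).1 ((hvm n) ▸ (hv n).sq_le_mass x))
  obtain ⟨u, -, φ, hφ, hlim⟩ :=
    (isCompact_univ_pi fun _ : Fin N → ℤ => isCompact_Icc).tendsto_subseq hbound
  rw [tendsto_pi_nhds] at hlim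
  replace hlim : ∀ x, Tendsto (fun n => v (φ n) x) atTop (𝓝 (u x)) := hlim
  have haφ : Tendsto (fun n => action V (v (φ n))) atTop (𝓝 (sInf (sphereValues V))) := by
    simp only [hva]
    exact ha.comp hφ.tendsto_atTop
  obtain ⟨hu, hum⟩ : SqSummable u ∧ mass u ≤ 1 :=
    summable_and_tsum_le_of_tendsto (fun n x => sq_nonneg (v (φ n) x))
      (fun n => (hvm (φ n)) ▸ Summable.hasSum (hv (φ n))) (fun x => (hlim x).pow 2)
      tendsto_const_nhds
  have hu0 : u ≠ 0 := by
    rintro rfl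
    have h := ge_of_tendsto' (tendsto_finsetSum (fundamentalBox N T) fun x _ => (hlim x).pow 2)
      fun n => hvb (φ n)
    simp only [Pi.zero_apply, ne_eq, OfNat.ofNat_ne_zero, not_false_eq_true, zero_pow,
      Finset.sum_const_zero] at h
    exact absurd h (not_le.2 (Real.exp_pos _))
  have hum1 := mass_eq_one_of_minimizing hVb hV1 (fun n => hv (φ n)) (fun n => hvl (φ n))
    (fun n => hvm (φ n)) haφ hlim hu hu0 hum
  have hdens : ∀ (f : (Fin N → ℤ) → ℝ) (x : Fin N → ℤ),
      0 ≤ gradForm (lattice N) f f x + (V x + 1) * f x ^ 2 := fun _ x =>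
    add_nonneg (gradForm_self_nonneg _ x) (mul_nonneg (by linarith [hV1 x]) (sq_nonneg _))
  -- Adding the mass, here `1`, makes the density of the action nonnegative: `V + 1 ≥ 0`, and `u²
  -- log u² ≤ 0` on the unit sphere.
  obtain ⟨hs, hle⟩ := summable_and_tsum_le_of_tendsto
    (g := fun n x => gradForm (lattice N) (v (φ n)) (v (φ n)) x + (V x + 1) * v (φ n) x ^ 2
      - v (φ n) x ^ 2 * Real.log (v (φ n) x ^ 2))
    (f := fun x => gradForm (lattice N) u u x + (V x + 1) * u x ^ 2
      - u x ^ 2 * Real.log (u x ^ 2))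
    (a := fun n => action V (v (φ n)) + 1)
    (fun n x => by
      linarith [hdens (v (φ n)) x, (hv (φ n)).sq_mul_log_nonpos (hvm (φ n)).le x])
    (fun n => by
      have := (hasSum_energy_density hVb (hv (φ n))).sub (Summable.hasSum (hvl (φ n)))
      rw [hvm, add_sub_right_comm] at this
      exact this)
    (fun x => by
      refine Tendsto.sub (Tendsto.add ?_ (((hlim x).pow 2).const_mul _))
        ((Real.continuous_mul_log.tendsto _).comp ((hlim x).pow 2))
      simp only [gradForm]
      exact (tendsto_finsetSum _ fun y _ => ((hlim y).sub (hlim x)).mul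
        ((hlim y).sub (hlim x))).const_mul _)
    (haφ.add_const 1)
  have hE := hasSum_energy_density hVb hu
  have hl : LogSummable u := by
    refine (hE.summable.sub hs).congr fun x => ?_
    ring
  have hact : action V u + 1 ≤ sInf (sphereValues V) + 1 := by
    rw [(hE.sub (Summable.hasSum hl)).tsum_eq, hum1] at hle
    rw [action]
    linarith
  exact ⟨u, hu, hl, hum1, le_antisymm (by linarith)
    (csInf_le (sphereValues_bddBelow hVb hV1) ⟨u, hu, hl, hum1, rfl⟩)⟩

end Minimizer

/-- The formula persists at `r = 0`, with `log 0 = 0`, because `t log t → 0`. Variations at vertices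
where `u` vanishes are thus legitimate. -/
theorem hasDerivAt_sq_mul_log_sq (r : ℝ) :
    HasDerivAt (fun t : ℝ => t ^ 2 * Real.log (t ^ 2)) (2 * r * Real.log (r ^ 2) + 2 * r) r := by
  rcases eq_or_ne r 0 with rfl | h
  · rw [hasDerivAt_iff_tendsto_slope_zero]
    have h0 : Tendsto (fun t : ℝ => 2 * (t * Real.log t)) (𝓝[≠] 0) (𝓝 0) := by
      have := (Real.continuous_mul_log.tendsto 0).const_mul 2
      simp only [zero_mul, mul_zero] at this
      exact this.mono_left nhdsWithin_le_nhds
    simp only [mul_zero, zero_mul, add_zero]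
    refine h0.congr' ?_
    filter_upwards [self_mem_nhdsWithin] with t ht
    have ht' : t ≠ 0 := ht
    simp only [zero_add, ne_eq, OfNat.ofNat_ne_zero, not_false_eq_true, zero_pow, zero_mul,
      sub_zero, smul_eq_mul, Real.log_pow, Nat.cast_ofNat]
    field_simp
  · have h1 : HasDerivAt (fun t : ℝ => t ^ 2) (2 * r) r := by simpa using hasDerivAt_pow 2 r
    refine (h1.mul (h1.log (pow_ne_zero 2 h))).congr_deriv ?_
    field_simp

/-! ### The Euler-Lagrange equation and the sign of solutions. -/

section EulerLagrange

variable {N : ℕ} {V u : (Fin N → ℤ) → ℝ}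

/-- Perturbing at one vertex alters one term, so no infinite sum has to be differentiated. -/
theorem hasSum_update_comp {α : Type*} {u : α → ℝ} (F : α → ℝ → ℝ) {a : ℝ} [DecidableEq α]
    (h : HasSum (fun y => F y (u y)) a) (x : α) (t : ℝ) :
    HasSum (fun y => F y ((u + t • (Pi.single x 1 : α → ℝ)) y)) (F x (u x + t) - F x (u x) + a) := by
  refine (h.update x (F x (u x + t))).congr_fun fun y => ?_
  by_cases hy : y = x
  · subst hy; simp
  · simp [hy]

/-- A minimizer in the inequality between action and mass satisfies the Euler-Lagrange
equation. -/
theorem euler_lagrange (hVb : ∃ C, ∀ x, |V x| ≤ C) (hV1 : ∀ x, -1 ≤ V x)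
    (hu : SqSummable u) (hl : LogSummable u) (h0 : u ≠ 0)
    (hmin : action V u = mass u * (sInf (sphereValues V) - Real.log (mass u)))
    (x : Fin N → ℤ) :
    -laplacian (lattice N) u x + V x * u x - u x * Real.log (u x ^ 2)
      = (sInf (sphereValues V) - Real.log (mass u)) * u x := by
  classical
  set d := sInf (sphereValues V)
  set δ : (Fin N → ℤ) → ℝ := Pi.single x 1
  have hδ : SqSummable δ :=
    .of_finite_support ((Set.finite_singleton x).subset Pi.support_single_subset)
  have hm : ∀ t : ℝ, mass (u + t • δ) = (u x + t) ^ 2 - u x ^ 2 + mass u := fun t =>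
    (hasSum_update_comp (fun _ r => r ^ 2) (Summable.hasSum hu) x t).tsum_eq
  have hL : ∀ t : ℝ, HasSum (fun y => (u + t • δ) y ^ 2
      * Real.log ((u + t • δ) y ^ 2))
      ((u x + t) ^ 2 * Real.log ((u x + t) ^ 2) - u x ^ 2 * Real.log (u x ^ 2)
        + ∑' y, u y ^ 2 * Real.log (u y ^ 2)) := fun t =>
    hasSum_update_comp (fun _ r => r ^ 2 * Real.log (r ^ 2)) (Summable.hasSum hl) x t
  have hP : ∀ t : ℝ, ∑' y, V y * (u + t • δ) y ^ 2
      = V x * (u x + t) ^ 2 - V x * u x ^ 2 + ∑' y, V y * u y ^ 2 := fun t =>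
    (hasSum_update_comp (fun y r => V y * r ^ 2) (hu.summable_potential hVb).hasSum x t).tsum_eq
  have hG : ∀ t : ℝ, gradPair (u + t • δ) (u + t • δ)
      = gradPair u u + 2 * (t * -laplacian (lattice N) u x)
        + t ^ 2 * gradPair δ δ := fun t => by
    rw [gradPair_add_self hu (hδ.smul t), gradPair_smul_self, gradPair_comm u (t • δ),
      gradPair_smul_left t δ u, gradPair_single_left x hu]
  -- The deficit in `mass_mul_le_action` is nonnegative and vanishes at `t = 0`; this replaces a
  -- constrained variation on the sphere.
  set φ : ℝ → ℝ := fun t => action V (u + t • δ)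
    - mass (u + t • δ) * (d - Real.log (mass (u + t • δ)))
  have hφ0 : φ 0 = 0 := by simp [φ, hmin]
  have hloc : IsLocalMin φ 0 := Eventually.of_forall fun t => by
    rw [hφ0]
    exact sub_nonneg.2 (mass_mul_le_action hVb hV1 (hu.add (hδ.smul t)) (hL t).summable)
  have hm0 := (hu.mass_pos h0).ne'
  have hid : HasDerivAt (fun t : ℝ => u x + t) 1 0 := by
    simpa using (hasDerivAt_id (0 : ℝ)).const_add (u x)
  have hsq : HasDerivAt (fun t : ℝ => (u x + t) ^ 2) (2 * u x) 0 := by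
    simpa [Pi.pow_def] using hid.pow 2
  have hdm : HasDerivAt (fun t : ℝ => (u x + t) ^ 2 - u x ^ 2 + mass u) (2 * u x) 0 := by
    simpa using (hsq.sub_const (u x ^ 2)).add_const (mass u)
  have hdL : HasDerivAt (fun t : ℝ => (u x + t) ^ 2 * Real.log ((u x + t) ^ 2))
      (2 * u x * Real.log (u x ^ 2) + 2 * u x) 0 := by
    have h := hasDerivAt_sq_mul_log_sq (u x + 0)
    have := HasDerivAt.comp (0 : ℝ) h hid
    rw [add_zero, mul_one] at this
    exact this
  have hdlog := hdm.log (by simpa using hm0)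
  have hlin : HasDerivAt (fun t : ℝ => 2 * (t * -laplacian (lattice N) u x))
      (2 * -laplacian (lattice N) u x) 0 := by
    simpa using ((hasDerivAt_id (0 : ℝ)).mul_const (-laplacian (lattice N) u x)).const_mul 2
  have hquad : HasDerivAt (fun t : ℝ => t ^ 2 * gradPair δ δ) 0 0 := by
    simpa using ((hasDerivAt_pow 2 (0 : ℝ)).mul_const
      (gradPair δ δ))
  have hder := (((((hlin.const_add (gradPair u u)).add hquad).add
    (((hsq.const_mul (V x)).sub_const (V x * u x ^ 2)).add_const (∑' y, V y * u y ^ 2))).sub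
    ((hdL.sub_const (u x ^ 2 * Real.log (u x ^ 2))).add_const
      (∑' y, u y ^ 2 * Real.log (u y ^ 2))))).sub (hdm.mul (hdlog.const_sub d))
  have hzero := hloc.hasDerivAt_eq_zero (hder.congr_of_eventuallyEq
    (Eventually.of_forall fun t => by simp only [φ, action, hm, hP, hG, (hL t).tsum_eq]; rfl))
  simp only [add_zero, sub_self, zero_add] at hzero
  -- The terms `2 * u x` coming from `r² log r²` and from `mass * log mass` cancel.
  field_simp at hzero
  linarith

/-- Multiply the equation by `u` and sum by parts. Log-summability comes for free, so every solution
in `ℓ²` has finite energy. -/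
theorem hasSum_log_of_solution (hVb : ∃ C, ∀ x, |V x| ≤ C) (hu : SqSummable u)
    (hsol : ∀ x, -laplacian (lattice N) u x + V x * u x = u x * Real.log (u x ^ 2)) :
    HasSum (fun x => u x ^ 2 * Real.log (u x ^ 2)) (gradPair u u + ∑' x, V x * u x ^ 2) := by
  rw [gradPair_eq_tsum_laplacian hu hu]
  refine ((hu.summable_mul_laplacian hu).hasSum.add
    (hu.summable_potential hVb).hasSum).congr_fun fun x => ?_
  linear_combination -u x * hsol x

/-- Strong maximum principle for nonnegative solutions. -/
theorem pos_of_nonneg_of_solution (h0 : u ≠ 0) (hnonneg : ∀ x, 0 ≤ u x)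
    (hsol : ∀ x, -laplacian (lattice N) u x + V x * u x = u x * Real.log (u x ^ 2))
    (x : Fin N → ℤ) : 0 < u x := by
  refine (hnonneg x).lt_of_ne' fun hx => h0 (funext fun y => ?_)
  refine lattice_induction (p := fun y => u y = 0) x hx (fun y z hyz hy => ?_) y
  have h := hsol y
  simp only [hy, laplacian, mul_zero, zero_mul, add_zero, sub_zero, neg_eq_zero] at h
  exact (Finset.sum_eq_zero_iff_of_nonneg fun w _ => hnonneg w).1 h z
    ((SimpleGraph.mem_neighborFinset _ _ _).2 hyz)

/-- If `u` and `|u|` both solve the equation, positivity of `u` at a vertex propagates. -/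
theorem forall_pos_of_solution_abs (hpos : ∀ x, 0 < |u x|)
    (hsol : ∀ x, -laplacian (lattice N) u x + V x * u x = u x * Real.log (u x ^ 2))
    (habs : ∀ x, -laplacian (lattice N) (fun y => |u y|) x + V x * |u x|
      = |u x| * Real.log (|u x| ^ 2))
    {x₀ : Fin N → ℤ} (hx₀ : 0 < u x₀) (x : Fin N → ℤ) : 0 < u x := by
  refine lattice_induction (p := fun x => 0 < u x) x₀ hx₀ (fun y z hyz hy => ?_) x
  have h1 := hsol y
  have h2 := habs y
  rw [abs_of_pos hy] at h2
  -- Where `u y > 0` the two equations agree except for the Laplacians, so the nonnegative numbers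
  -- `|u z| - u z` over neighbours `z` sum to zero.
  have h3 : laplacian (lattice N) (fun y => |u y|) y - laplacian (lattice N) u y = 0 := by
    linarith
  rw [laplacian, laplacian, ← Finset.sum_sub_distrib] at h3
  simp only [abs_of_pos hy, sub_sub_sub_cancel_right] at h3
  have h4 := (Finset.sum_eq_zero_iff_of_nonneg fun w _ => sub_nonneg.2 (le_abs_self (u w))).1 h3 z
    ((SimpleGraph.mem_neighborFinset _ _ _).2 hyz)
  rw [← sub_eq_zero.1 h4]
  exact hpos z

end EulerLagrange

/-! ### Continuity of the mass along paths. -/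

section MountainPass

variable {N : ℕ} {V u : (Fin N → ℤ) → ℝ}

/-- For `a > -1` the norm of `X` controls the `ℓ²` norm, so paths continuous in `X` are continuous
in `ℓ²`. -/
theorem mass_le_energy (hVb : ∃ C, ∀ x, |V x| ≤ C) {a : ℝ} (ha : ∀ x, a ≤ V x)
    (hu : SqSummable u) :
    (a + 1) * mass u ≤ gradPair u u + ∑' x, V x * u x ^ 2 + mass u := by
  have h : a * mass u ≤ ∑' x, V x * u x ^ 2 := by
    rw [mass, ← tsum_mul_left]
    exact (Summable.mul_left a hu).tsum_le_tsum
      (fun x => mul_le_mul_of_nonneg_right (ha x) (sq_nonneg _)) (hu.summable_potential hVb)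
  linarith [gradPair_self_nonneg u]

/-- A map into `ℓ²` that is continuous in the norm has continuous mass. -/
theorem continuous_mass {S α : Type*} [TopologicalSpace S] {γ : S → α → ℝ}
    (hγ : ∀ s, SqSummable (γ s))
    (hcont : ∀ s, Tendsto (fun r => mass (γ r - γ s)) (𝓝 s) (𝓝 0)) :
    Continuous fun s => mass (γ s) := by
  have hmem : ∀ s, Memℓp (γ s) 2 := fun s => by
    rw [memℓp_gen_iff (by norm_num)]
    simpa [SqSummable] using hγ s
  set Γ : S → lp (fun _ : α => ℝ) 2 := fun s => ⟨γ s, hmem s⟩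
  have hnorm : ∀ f : lp (fun _ : α => ℝ) 2, ‖f‖ ^ 2 = mass (f : α → ℝ) := fun f => by
    have := lp.norm_rpow_eq_tsum (p := 2) (by norm_num) f
    simpa [mass] using this
  have hΓ : Continuous Γ := by
    rw [continuous_iff_continuousAt]
    intro s
    rw [ContinuousAt, tendsto_iff_norm_sub_tendsto_zero]
    have h := (Real.continuous_sqrt.tendsto 0).comp (hcont s)
    rw [Real.sqrt_zero] at h
    refine h.congr fun r => ?_
    have h1 : ‖Γ r - Γ s‖ ^ 2 = mass (γ r - γ s) := hnorm _
    simp only [Function.comp_apply, ← h1, Real.sqrt_sq (norm_nonneg _)]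
  exact (hΓ.norm.pow 2).congr fun s => hnorm (Γ s)

end MountainPass

/-! ### The Nehari and mountain-pass levels. -/

section Levels

variable {N : ℕ} {V u : (Fin N → ℤ) → ℝ}

theorem J_eq_half_mass (hVb : ∃ C, ∀ x, |V x| ≤ C) (hu : u ∈ nehari (lattice N) V) :
    J (lattice N) V u = ((mass u / 2 : ℝ) : EReal) := by
  obtain ⟨hs, hl, -, h⟩ := (mem_nehari_iff hVb).1 hu
  rw [J_eq_of_logSummable hVb hs hl, h, zero_add]

theorem exp_le_mass_of_mem_nehari (hVb : ∃ C, ∀ x, |V x| ≤ C) (hV1 : ∀ x, -1 ≤ V x)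
    (hu : u ∈ nehari (lattice N) V) : Real.exp (sInf (sphereValues V)) ≤ mass u := by
  obtain ⟨hs, hl, h0, h⟩ := (mem_nehari_iff hVb).1 hu
  have hm := hs.mass_pos h0
  have h1 := mass_mul_le_action hVb hV1 hs hl
  rw [h] at h1
  have h2 : sInf (sphereValues V) - Real.log (mass u) ≤ 0 := nonpos_of_mul_nonpos_right h1 hm
  exact (Real.le_log_iff_exp_le hm).1 (by linarith)

theorem exists_nehari_minimizer {T : ℕ} (hT : 0 < T) (hper : IsPeriodic T V)
    (hVb : ∃ C, ∀ x, |V x| ≤ C) (hV1 : ∀ x, -1 ≤ V x) :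
    ∃ u ∈ nehari (lattice N) V, mass u = Real.exp (sInf (sphereValues V)) := by
  obtain ⟨v, hv, hl, hm, ha⟩ := exists_action_minimizer hT hper hVb hV1
  set d := sInf (sphereValues V)
  -- The factor `c = exp (d / 2)` makes `log c² = d`, which is what annihilates the action of `c •
  -- v`.
  have hc : Real.exp (d / 2) ≠ 0 := (Real.exp_pos _).ne'
  have hc2 : Real.exp (d / 2) ^ 2 = Real.exp d := by
    rw [sq, ← Real.exp_add, add_halves]
  have hmass : mass (Real.exp (d / 2) • v) = Real.exp d := by rw [mass_smul, hc2, hm, mul_one]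
  refine ⟨Real.exp (d / 2) • v, (mem_nehari_iff hVb).2
    ⟨hv.smul _, (hasSum_log_smul hv hl hc).summable, ?_, ?_⟩, hmass⟩
  · intro h
    rw [h, show mass (0 : (Fin N → ℤ) → ℝ) = 0 by simp [mass]] at hmass
    exact (Real.exp_pos d).ne hmass
  · rw [action_smul hv hl hc, hc2, Real.log_exp, ha, hm, mul_one, sub_self, mul_zero]

/-- The multiplier `d - log (mass u)` in `euler_lagrange` vanishes at the critical mass. -/
theorem solution_of_mass_eq_exp (hVb : ∃ C, ∀ x, |V x| ≤ C) (hV1 : ∀ x, -1 ≤ V x)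
    (hu : u ∈ nehari (lattice N) V) (hm : mass u = Real.exp (sInf (sphereValues V)))
    (x : Fin N → ℤ) : -laplacian (lattice N) u x + V x * u x = u x * Real.log (u x ^ 2) := by
  obtain ⟨hs, hl, h0, h⟩ := (mem_nehari_iff hVb).1 hu
  have h1 := euler_lagrange hVb hV1 hs hl h0 (by rw [h, hm, Real.log_exp, sub_self, mul_zero]) x
  rw [hm, Real.log_exp, sub_self, zero_mul] at h1
  linarith

theorem mem_nehari_of_isSolution (hVb : ∃ C, ∀ x, |V x| ≤ C)
    (hu : IsSolution (lattice N) V u) (h0 : u ≠ 0) : u ∈ nehari (lattice N) V := by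
  have hs : SqSummable u := mem_H1_iff.1 hu.1.1
  have h := hasSum_log_of_solution hVb hs hu.2
  exact (mem_nehari_iff hVb).2 ⟨hs, h.summable, h0, by rw [action, h.tsum_eq, sub_self]⟩

/-- Taking absolute values does not raise the action, and at the critical mass the action cannot be
negative. -/
theorem abs_mem_nehari_of_mass_eq_exp (hVb : ∃ C, ∀ x, |V x| ≤ C) (hV1 : ∀ x, -1 ≤ V x)
    (hu : u ∈ nehari (lattice N) V) (hm : mass u = Real.exp (sInf (sphereValues V))) :
    (fun x => |u x|) ∈ nehari (lattice N) V := by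
  obtain ⟨hs, hl, h0, h⟩ := (mem_nehari_iff hVb).1 hu
  refine (mem_nehari_iff hVb).2 ⟨hs.abs, hl.abs, ?_, ?_⟩
  · exact fun h' => h0 (funext fun x => abs_eq_zero.1 (congrFun h' x))
  · refine le_antisymm (h ▸ action_abs_le hs) ?_
    have h1 := mass_mul_le_action hVb hV1 hs.abs hl.abs
    rwa [mass_abs, hm, Real.log_exp, sub_self, mul_zero] at h1

theorem laplacian_neg (u : (Fin N → ℤ) → ℝ) (x : Fin N → ℤ) :
    laplacian (lattice N) (fun y => -u y) x = -laplacian (lattice N) u x := by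
  rw [laplacian, laplacian, ← Finset.sum_neg_distrib]
  exact Finset.sum_congr rfl fun y _ => by ring

theorem pos_or_neg_of_mass_eq_exp (hVb : ∃ C, ∀ x, |V x| ≤ C) (hV1 : ∀ x, -1 ≤ V x)
    (hu : u ∈ nehari (lattice N) V) (hm : mass u = Real.exp (sInf (sphereValues V))) :
    (∀ x, 0 < u x) ∨ ∀ x, u x < 0 := by
  have habs := abs_mem_nehari_of_mass_eq_exp hVb hV1 hu hm
  have hsol := solution_of_mass_eq_exp hVb hV1 hu hm
  have hsol' := solution_of_mass_eq_exp hVb hV1 habs ((mass_abs u).trans hm)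
  have hpos := pos_of_nonneg_of_solution ((mem_nehari_iff hVb).1 habs).2.2.1
    (fun x => abs_nonneg (u x)) hsol'
  rcases lt_or_gt_of_ne (abs_pos.1 (hpos 0)) with h | h
  · right
    intro x
    refine neg_pos.1 (forall_pos_of_solution_abs (u := fun x => -u x) (V := V) (x₀ := 0)
      (fun x => by simpa using hpos x) (fun x => ?_) (fun x => ?_) (neg_pos.2 h) x)
    · rw [laplacian_neg, neg_sq]
      linarith [hsol x]
    · simpa only [abs_neg] using hsol' x
  · exact .inl (forall_pos_of_solution_abs hpos hsol hsol' h)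

theorem le_J_of_mass_eq_exp (hVb : ∃ C, ∀ x, |V x| ≤ C) (hV1 : ∀ x, -1 ≤ V x)
    (hs : SqSummable u) (hm : mass u = Real.exp (sInf (sphereValues V))) :
    ((Real.exp (sInf (sphereValues V)) / 2 : ℝ) : EReal) ≤ J (lattice N) V u := by
  by_cases hl : LogSummable u
  · have h := mass_mul_le_action hVb hV1 hs hl
    rw [hm, Real.log_exp, sub_self, mul_zero] at h
    rw [J_eq_of_logSummable hVb hs hl, hm, EReal.coe_le_coe_iff]
    linarith
  · rw [J_eq_top hVb hs hl]
    exact le_top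

theorem exp_lt_mass_of_J_neg (hVb : ∃ C, ∀ x, |V x| ≤ C) (hV1 : ∀ x, -1 ≤ V x)
    (hs : SqSummable u) (hJ : J (lattice N) V u < 0) :
    Real.exp (sInf (sphereValues V)) < mass u := by
  by_cases hl : LogSummable u
  · rw [J_eq_of_logSummable hVb hs hl, EReal.coe_neg'] at hJ
    have h := mass_mul_le_action hVb hV1 hs hl
    have hm : 0 < mass u := by
      refine (mass_nonneg u).lt_of_ne' fun h0 => ?_
      rw [h0, zero_mul] at h
      rw [h0] at hJ
      linarith
    -- Negative energy means `action + mass < 0`, which even gives `log (mass u) > d + 1`.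
    have h1 : mass u * (sInf (sphereValues V) - Real.log (mass u) + 1) < 0 := by linarith
    have h2 := neg_of_mul_neg_right h1 hm.le
    exact (Real.lt_log_iff_exp_lt hm).1 (by linarith)
  · rw [J_eq_top hVb hs hl] at hJ
    exact absurd hJ (not_lt.2 le_top)

/-- Every mountain path crosses the sphere on which the energy is at least the Nehari level. -/
theorem le_mountainPassLevel (hVb : ∃ C, ∀ x, |V x| ≤ C) {a : ℝ} (ha : -1 < a)
    (haV : ∀ x, a ≤ V x) :
    ((Real.exp (sInf (sphereValues V)) / 2 : ℝ) : EReal)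
      ≤ mountainPassLevel (lattice N) V := by
  have hV1 : ∀ x, -1 ≤ V x := fun x => ha.le.trans (haV x)
  refine le_iInf₂ fun γ hγ => ?_
  obtain ⟨hX, hcont, hγ0, hγ1⟩ := hγ
  have hs : ∀ s, SqSummable (γ s) := fun s => mem_H1_iff.1 (hX s).1
  have hmc : Continuous fun s => mass (γ s) := by
    refine continuous_mass hs fun s => ?_
    have h1 : Tendsto (fun r => (a + 1)⁻¹ * (xNormSq (lattice N) V (γ r - γ s)).toReal)
        (𝓝 s) (𝓝 0) := by
      have := (ENNReal.tendsto_toReal ENNReal.zero_ne_top).comp (hcont s)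
      simpa using this.const_mul (a + 1)⁻¹
    refine squeeze_zero (fun r => mass_nonneg _) (fun r => ?_) h1
    have h2 := mass_le_energy hVb haV ((hs r).sub (hs s))
    have ha1 : 0 < a + 1 := by linarith
    rw [xNormSq_eq_ofReal hVb hV1 ((hs r).sub (hs s)), ENNReal.toReal_ofReal
      ((mul_nonneg ha1.le (mass_nonneg _)).trans h2), inv_mul_eq_div, le_div_iff₀ ha1]
    linarith
  obtain ⟨s, hms⟩ : Real.exp (sInf (sphereValues V)) ∈ Set.range fun s => mass (γ s) := by
    refine mem_range_of_exists_le_of_exists_ge hmc ⟨0, ?_⟩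
      ⟨1, (exp_lt_mass_of_J_neg hVb hV1 (hs 1) hγ1).le⟩
    simp [hγ0, mass, (Real.exp_pos _).le]
  exact (le_J_of_mass_eq_exp hVb hV1 (hs s) hms).trans (le_iSup (fun s => J (lattice N) V (γ s)) s)

theorem J_smul_of_mem_nehari (hVb : ∃ C, ∀ x, |V x| ≤ C) (hu : u ∈ nehari (lattice N) V)
    {c : ℝ} (hc : c ≠ 0) : J (lattice N) V (c • u)
      = ((c ^ 2 * (1 - Real.log (c ^ 2)) * (mass u / 2) : ℝ) : EReal) := by
  obtain ⟨hs, hl, -, h⟩ := (mem_nehari_iff hVb).1 hu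
  rw [J_eq_of_logSummable hVb (hs.smul c) (hasSum_log_smul hs hl hc).summable,
    action_smul hs hl hc, mass_smul, h]
  congr 1
  ring

/-- With `r = c²` this says that energy along a ray peaks at its Nehari point, `c = 1`. -/
theorem mul_one_sub_log_le_one {r : ℝ} (hr : 0 < r) : r * (1 - Real.log r) ≤ 1 := by
  have h := Real.log_le_sub_one_of_pos (inv_pos.2 hr)
  rw [Real.log_inv] at h
  calc r * (1 - Real.log r) ≤ r * r⁻¹ := mul_le_mul_of_nonneg_left (by linarith) hr.le
    _ = 1 := mul_inv_cancel₀ hr.ne'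

/-- The ray through a point of the Nehari manifold is, suitably long, a mountain path whose
highest point has the energy of that point. -/
theorem mountainPassLevel_le_J (hVb : ∃ C, ∀ x, |V x| ≤ C) (hV1 : ∀ x, -1 ≤ V x)
    (hu : u ∈ nehari (lattice N) V) :
    mountainPassLevel (lattice N) V ≤ J (lattice N) V u := by
  obtain ⟨hs, hl, h0, h⟩ := (mem_nehari_iff hVb).1 hu
  have hm := hs.mass_pos h0
  -- At the endpoint the energy factor `R² (1 - log R²)` equals `-R²`, hence is negative.
  set R : ℝ := Real.exp 1
  have hR : R ≠ 0 := (Real.exp_pos 1).ne'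
  have hlogR : Real.log (R ^ 2) = 2 := by simp [R]
  have hpath : ∀ s : unitInterval, J (lattice N) V (((s : ℝ) * R) • u) ≤ J (lattice N) V u := by
    intro s
    rw [J_eq_half_mass hVb hu]
    rcases eq_or_ne ((s : ℝ) * R) 0 with hz | hz
    · rw [hz, zero_smul, J_eq_of_logSummable hVb (by simp [SqSummable, summable_zero])
        (by simp [LogSummable, summable_zero]), EReal.coe_le_coe_iff]
      simp [action, mass, gradPair, gradForm]
      exact div_nonneg (mass_nonneg u) two_pos.le
    · rw [J_smul_of_mem_nehari hVb hu hz, EReal.coe_le_coe_iff]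
      have := mul_one_sub_log_le_one (pow_pos (abs_pos.2 hz) 2)
      rw [sq_abs] at this
      nlinarith
  refine (iInf₂_le (fun s : unitInterval => ((s : ℝ) * R) • u)
    ⟨fun s => ?_, fun s => ?_, ?_, ?_⟩).trans (iSup_le hpath)
  · exact (mem_X_iff (hVb.imp fun C hC x => (le_abs_self _).trans (hC x))).2 (hs.smul _)
  · have hE : ∀ r : unitInterval,
        xNormSq (lattice N) V (((r : ℝ) * R) • u - ((s : ℝ) * R) • u)
          = ENNReal.ofReal ((((r : ℝ) - s) * R) ^ 2
            * (gradPair u u + ∑' x, V x * u x ^ 2 + mass u)) := by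
      intro r
      rw [← sub_smul, ← sub_mul, xNormSq_eq_ofReal hVb hV1 (hs.smul _), gradPair_smul_self,
        potential_smul, mass_smul, mul_add, mul_add]
    simp only [hE]
    have hc : Continuous fun r : unitInterval => ENNReal.ofReal ((((r : ℝ) - s) * R) ^ 2
        * (gradPair u u + ∑' x, V x * u x ^ 2 + mass u)) :=
      ENNReal.continuous_ofReal.comp (by fun_prop)
    simpa using hc.tendsto s
  · simp
  · change J (lattice N) V (((1 : ℝ) * R) • u) < 0
    rw [one_mul, J_smul_of_mem_nehari hVb hu hR, hlogR,
      EReal.coe_neg']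
    have : 0 < R ^ 2 := by positivity
    nlinarith

theorem nehariLevel_eq (hVb : ∃ C, ∀ x, |V x| ≤ C) (hV1 : ∀ x, -1 ≤ V x)
    (hu : u ∈ nehari (lattice N) V) (hm : mass u = Real.exp (sInf (sphereValues V))) :
    nehariLevel (lattice N) V = ((Real.exp (sInf (sphereValues V)) / 2 : ℝ) : EReal) := by
  refine le_antisymm ((iInf₂_le u hu).trans_eq (by rw [J_eq_half_mass hVb hu, hm])) ?_
  refine le_iInf₂ fun w hw => ?_
  rw [J_eq_half_mass hVb hw, EReal.coe_le_coe_iff]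
  linarith [exp_le_mass_of_mem_nehari hVb hV1 hw]

end Levels

end LogSchrodinger

theorem theorem1p2 (N T : ℕ) (hT : 0 < T) (V : (Fin N → ℤ) → ℝ)
    (hper : LogSchrodinger.IsPeriodic T V)
    (hV : ∃ a : ℝ, -1 < a ∧ ∀ x, a ≤ V x) :
    (∃ u, LogSchrodinger.IsGroundState (LogSchrodinger.lattice N) V u) ∧
    LogSchrodinger.mountainPassLevel (LogSchrodinger.lattice N) V
      = LogSchrodinger.nehariLevel (LogSchrodinger.lattice N) V ∧
    ∀ u, LogSchrodinger.IsGroundState (LogSchrodinger.lattice N) V u →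
      u ∈ LogSchrodinger.nehari (LogSchrodinger.lattice N) V ∧
      LogSchrodinger.J (LogSchrodinger.lattice N) V u
        = LogSchrodinger.mountainPassLevel (LogSchrodinger.lattice N) V ∧
      ((∀ x, 0 < u x) ∨ (∀ x, u x < 0)) := by
  open LogSchrodinger in
  obtain ⟨a, ha, haV⟩ := hV
  have hV1 : ∀ x, -1 ≤ V x := fun x => ha.le.trans (haV x)
  obtain ⟨C, hC⟩ := hper.bddAbove hT
  have hVb : ∃ C, ∀ x, |V x| ≤ C := ⟨max C 1, fun x =>
    abs_le.2 ⟨by linarith [hV1 x, le_max_right C 1], (hC x).trans (le_max_left C 1)⟩⟩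
  obtain ⟨v, hv, hvm⟩ := exists_nehari_minimizer hT hper hVb hV1
  have hvJ : J (lattice N) V v = ((Real.exp (sInf (sphereValues V)) / 2 : ℝ) : EReal) := by
    rw [J_eq_half_mass hVb hv, hvm]
  have hlevel := nehariLevel_eq hVb hV1 hv hvm
  have hmp : mountainPassLevel (lattice N) V = nehariLevel (lattice N) V := by
    rw [hlevel]
    exact le_antisymm ((mountainPassLevel_le_J hVb hV1 hv).trans_eq hvJ)
      (le_mountainPassLevel hVb ha haV)
  have hle : ∀ w ∈ nehari (lattice N) V, J (lattice N) V v ≤ J (lattice N) V w := by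
    intro w hw
    rw [hvJ, ← hlevel]
    exact iInf₂_le w hw
  have hvsol : IsSolution (lattice N) V v :=
    ⟨hv.1.1, solution_of_mass_eq_exp hVb hV1 hv hvm⟩
  refine ⟨⟨v, hvsol, hv.2.1, hv.1.2, fun w hw hw0 =>
    hle w (mem_nehari_of_isSolution hVb hw hw0)⟩, hmp, fun u hu => ?_⟩
  have hun := mem_nehari_of_isSolution hVb hu.1 hu.2.1
  have huJ : J (lattice N) V u = J (lattice N) V v :=
    le_antisymm (hu.2.2.2 v hvsol hv.2.1) (hle u hun)
  -- On the Nehari manifold `J` is half the mass, so minimal energy forces the critical mass.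
  have hum : mass u = Real.exp (sInf (sphereValues V)) := by
    rw [hvJ, J_eq_half_mass hVb hun, EReal.coe_eq_coe_iff] at huJ
    linarith
  exact ⟨hun, by rw [huJ, hvJ, hmp, hlevel], pos_or_neg_of_mass_eq_exp hVb hV1 hun hum⟩
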